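/- **Definitions.** All graphs are finite and simple. *Reflection complexes.* A $b$-hypergraph $M=(V,E,B)$ is a finite vertex set $V$ with a set $E\subseteq 2^V$ of edges and a symmetric relation $B\subseteq 2^V\times 2^V$; its restriction to $L\subseteq V$ consists of the edges contained in $L$ and of the relation $B\cap(2^L\times 2^L)$. The *frame* $\mathcal F(M)$ is the graph on $V$ whose edges are the two-element edges of $M$. For $L\in E$ and $X\subseteq L$ let $N$ be the restriction of $M$ to $L$. The $b$-hypergraph $r_{L,X}(M)$ is obtained as follows: take disjoint copies of $M$ and $N$ and identify the two copies of each vertex of $X$; write $\tau_1:V\to V'$ and $\tau_2:L\to V'$ for the resulting injections into the glued vertex set $V'$. The edges are the $\tau_1$-images of the edges of $M$, the $\tau_2$-images of the edges of $N$, and all sets $\tau_1(K_1)\cup\tau_2(K_2)$ with $K_1$ an edge of $M$, $K_2$ an edge of $N$ and $X\subseteq K_1\cap K_2$. The relation consists of the images of the relations of $M$ and $N$ and of all pairs $(\tau_1(K_1),\tau_2(K_2))$ (and their reverses) with $K_1,K_2$ as before. A *reflection complex* is a $b$-hypergraph obtained by finitely many operations $r_{L,X}$ from the trivial one, which has $V=\{1,2\}$,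 $E=\{\{1,2\}\}$, $B=\emptyset$. *Thick graphs.* For $S\subseteq V$ let $1_S\in\mathbb R^{2^V}$ be the set function with value $1$ at $S$ and $0$ elsewhere, and let $t_{A,B}=1_{A\cup B}-1_A-1_B+1_{A\cap B}$. Let $W_B$ be the linear span of the $t_{A,C}$ with $(A,C)\in B$, and let $Q_V$ be the sum of the line spanned by $1_\emptyset$ and the cone of non-negative linear combinations of all $t_{A,C}$ and all $1_A$ ($A,C\subseteq V$). A reflection complex $M=(V,E,B)$ with frame $H$ is *thick* if $$-1_V+\sum_{e\in E(H)}1_e-\sum_{v\in V}(\deg_H(v)-1)\,1_{\{v\}}\ \in\ W_B+Q_V .$$ A graph is *thick* if it is isomorphic to the frame of a thick reflection complex. *Sidorenko's conjecture.* Let $t(H,G)$ be the probability that a uniformly random map $V(H)\to V(G)$ is a graph homomorphism, and let $e$ be the single edge. A graph $H$ satisfies Sidorenko's conjecture if $t(H,G)\ge t(e,G)^{|E(H)|}$ for every finite graph $G$ with at least one vertex. *Products.* In the Cartesian product $H_1\square H_2$, with vertex set $V(H_1)\times V(H_2)$, two vertices are adjacent if they agree in one coordinate and are adjacent in the other. The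 $n$-dimensional hypercube is the graph on $\{0,1\}^n$ in which two vertices are adjacent if their Hamming distance is $1$. An $n$-dimensional grid is a product $P_1\square\cdots\square P_n$ of paths with at least one vertex each. For $n=0$ the hypercube and the grid are the one-vertex graph. **Statement.** 1. If $H_1$ is a tree and $H_2$ is a thick graph, then $H_1\square H_2$ is thick. 2. For every $n\ge 1$ the $n$-dimensional hypercube is thick, and for every $n\ge 0$ it satisfies Sidorenko's conjecture. 3. Every grid $P_1\square\cdots\square P_n$ in which at least one path $P_i$ has an edge is thick, and every grid $P_1\square\cdots\square P_n$, $n\ge0$, satisfies Sidorenko's conjecture. -/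

import Mathlib

open scoped Pointwise

/-- A hypergraph on the vertex set `V` together with a symmetric binary relation on the subsets
of `V`. -/
structure BHypergraph (V : Type*) where
  edges : Set (Set V)
  rel : Set V → Set V → Prop
  rel_symm : ∀ A B, rel A B → rel B A

namespace BHypergraph

/-- The sub-`b`-hypergraph on `L ⊆ V`: the edges contained in `L`, and the relation restricted to
the subsets of `L`. -/
def induce {V : Type*} (M : BHypergraph V) (L : Set V) : BHypergraph L where
  edges := {K | Subtype.val '' K ∈ M.edges}
  rel A B := M.rel (Subtype.val '' A) (Subtype.val '' B)
  rel_symm _ _ h := M.rel_symm _ _ h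

/-- The frame: the graph formed by the edges of size two. -/
def frame {V : Type*} (M : BHypergraph V) : SimpleGraph V where
  Adj u v := u ≠ v ∧ {u, v} ∈ M.edges
  symm := ⟨fun u v h => ⟨h.1.symm, by rw [Set.pair_comm]; exact h.2⟩⟩
  loopless := ⟨fun _ h => h.1 rfl⟩

/-- `V`, with the injections `τ₁ : V₁ → V` and `τ₂ : V₂ → V`, is obtained from the disjoint union of
`V₁` and `V₂` by identifying `φ₁ f` with `φ₂ f` for every label `f`. -/
structure IsVertexGluing {F V₁ V₂ V : Type*} (φ₁ : F → V₁) (φ₂ : F → V₂)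
    (τ₁ : V₁ → V) (τ₂ : V₂ → V) : Prop where
  injective_left : Function.Injective τ₁
  injective_right : Function.Injective τ₂
  eq_iff : ∀ v₁ v₂, τ₁ v₁ = τ₂ v₂ ↔ ∃ f, φ₁ f = v₁ ∧ φ₂ f = v₂
  cover : Set.range τ₁ ∪ Set.range τ₂ = Set.univ

/-- The extended gluing `M₁ ∪* M₂` of two `b`-hypergraphs along `φ₁ : F → V₁` and `φ₂ : F → V₂`,
on the glued vertex set `V`. The last edges and relations, coming from pairs of edges
`K₁ ⊇ φ₁(F)` of `M₁` and `K₂ ⊇ φ₂(F)` of `M₂`, are those of the second type. -/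
def starGlue {F V₁ V₂ V : Type*} (M₁ : BHypergraph V₁) (M₂ : BHypergraph V₂)
    (φ₁ : F → V₁) (φ₂ : F → V₂) (τ₁ : V₁ → V) (τ₂ : V₂ → V) : BHypergraph V where
  edges := {K | (∃ K₁ ∈ M₁.edges, K = τ₁ '' K₁) ∨ (∃ K₂ ∈ M₂.edges, K = τ₂ '' K₂) ∨
    ∃ K₁ ∈ M₁.edges, ∃ K₂ ∈ M₂.edges, Set.range φ₁ ⊆ K₁ ∧ Set.range φ₂ ⊆ K₂ ∧
      K = τ₁ '' K₁ ∪ τ₂ '' K₂}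
  rel A B := (∃ A₁ B₁, M₁.rel A₁ B₁ ∧ A = τ₁ '' A₁ ∧ B = τ₁ '' B₁) ∨
    (∃ A₂ B₂, M₂.rel A₂ B₂ ∧ A = τ₂ '' A₂ ∧ B = τ₂ '' B₂) ∨
    ∃ K₁ ∈ M₁.edges, ∃ K₂ ∈ M₂.edges, Set.range φ₁ ⊆ K₁ ∧ Set.range φ₂ ⊆ K₂ ∧
      ((A = τ₁ '' K₁ ∧ B = τ₂ '' K₂) ∨ (A = τ₂ '' K₂ ∧ B = τ₁ '' K₁))
  rel_symm := by
    rintro A B (⟨A₁, B₁, h, hA, hB⟩ | ⟨A₂, B₂, h, hA, hB⟩ | ⟨K₁, h₁, K₂, h₂, hF₁, hF₂, h⟩)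
    · exact Or.inl ⟨B₁, A₁, M₁.rel_symm _ _ h, hB, hA⟩
    · exact Or.inr (Or.inl ⟨B₂, A₂, M₂.rel_symm _ _ h, hB, hA⟩)
    · exact Or.inr (Or.inr ⟨K₁, h₁, K₂, h₂, hF₁, hF₂, h.symm.imp And.symm And.symm⟩)

/-- The trivial reflection complex: two vertices, one edge containing both, the empty relation. -/
def trivialComplex : BHypergraph (Fin 2) where
  edges := {Set.univ}
  rel _ _ := False
  rel_symm _ _ h := h

/-- Reflection complexes: the `b`-hypergraphs obtained from the trivial reflection complex by
finitely many operations `M ↦ r_{L,X}(M)`, where `L` is an edge of `M`, `X ⊆ L`, and `r_{L,X}(M)` is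
the extended gluing of `M` with its own sub-`b`-hypergraph on `L` along the two inclusions of
`X`. -/
inductive IsReflectionComplex : ∀ {V : Type}, BHypergraph V → Prop
  | trivial : IsReflectionComplex trivialComplex
  | reflect {V V' : Type} {M : BHypergraph V} {L X : Set V} (hM : IsReflectionComplex M)
      (hL : L ∈ M.edges) (hX : X ⊆ L) (τ₁ : V → V') (τ₂ : L → V')
      (hτ : IsVertexGluing (Subtype.val : X → V) (Set.inclusion hX) τ₁ τ₂) :
      IsReflectionComplex
        (starGlue M (M.induce L) (Subtype.val : X → V) (Set.inclusion hX) τ₁ τ₂)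

end BHypergraph

noncomputable section

/-- The set function `1_S`, with value `1` at `S` and `0` at every other subset of `V`. -/
def oneAt {V : Type*} (S : Set V) : Set V → ℝ :=
  Set.indicator {S} 1

/-- `t_{A,B} = 1_{A ∪ B} - 1_A - 1_B + 1_{A ∩ B}`. -/
def tVec {V : Type*} (A B : Set V) : Set V → ℝ :=
  oneAt (A ∪ B) - oneAt A - oneAt B + oneAt (A ∩ B)

/-- `W_b`: the linear span of the `t_{A,B}` with `(A, B)` in the relation `b`. -/
def relSpan {V : Type*} (b : Set V → Set V → Prop) : Submodule ℝ (Set V → ℝ) :=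
  Submodule.span ℝ {w | ∃ A B, b A B ∧ w = tVec A B}

/-- `Q_V`: the line spanned by `1_∅` plus the cone of all non-negative linear combinations of the
vectors `t_{A,B}` and `1_A`. -/
def coneQ (V : Type*) : Set (Set V → ℝ) :=
  (Submodule.span ℝ {oneAt (∅ : Set V)} : Set (Set V → ℝ)) +
    (Submodule.span NNReal ({w | ∃ A B : Set V, w = tVec A B} ∪ {w | ∃ A : Set V, w = oneAt A}) :
      Set (Set V → ℝ))

open Classical in
/-- `h_H(X) = -1_X + ∑_{e ∈ E(F)} 1_e - ∑_{v ∈ X} (deg_F(v) - 1) 1_{v}`, where `F` is the graph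
spanned on `X` in `H`. -/
def hVec {V : Type*} [Fintype V] (H : SimpleGraph V) (X : Set V) : Set V → ℝ :=
  -oneAt X + ∑ e ∈ H.edgeFinset with (e : Set V) ⊆ X, oneAt (e : Set V)
    - ∑ v : V with v ∈ X, (((H.neighborSet v ∩ X).ncard : ℝ) - 1) • oneAt {v}

/-- A `b`-hypergraph is thick if `h_H(V) ∈ W_B + Q_V`, where `H` is its frame. -/
def BHypergraph.IsThick {V : Type*} [Fintype V] (M : BHypergraph V) : Prop :=
  hVec M.frame Set.univ ∈ (relSpan M.rel : Set (Set V → ℝ)) + coneQ V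

/-- Thick graphs: the graphs that are (up to isomorphism) frames of thick reflection complexes. -/
def SimpleGraph.IsThick {V : Type*} (H : SimpleGraph V) : Prop :=
  ∃ (W : Type) (_ : Fintype W) (M : BHypergraph W),
    M.IsReflectionComplex ∧ M.IsThick ∧ Nonempty (H ≃g M.frame)

/-- `t(H, G)`: the probability that a uniformly random map from the vertices of `H` to the vertices
of `G` is a homomorphism. -/
def homDensity {V W : Type*} (H : SimpleGraph V) (G : SimpleGraph W) : ℝ :=
  (Nat.card (H →g G) : ℝ) / (Nat.card W : ℝ) ^ Nat.card V

/-- `H` satisfies Sidorenko's conjecture: `t(H, G) ≥ t(e, G) ^ |E(H)|` for every finite graph `G`,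
where `e` is the single edge. -/
def SimpleGraph.SatisfiesSidorenko {V : Type*} (H : SimpleGraph V) : Prop :=
  ∀ (W : Type) [Finite W] [Nonempty W] (G : SimpleGraph W),
    homDensity (⊤ : SimpleGraph (Fin 2)) G ^ Nat.card H.edgeSet ≤ homDensity H G

end

/-- The `n`-dimensional hypercube: two `0-1` sequences of length `n` are adjacent if their Hamming
distance is `1`. -/
def hypercube (n : ℕ) : SimpleGraph (Fin n → Bool) where
  Adj x y := hammingDist x y = 1
  symm := ⟨fun x y h => by rw [hammingDist_comm]; exact h⟩
  loopless := ⟨fun x h => by simp at h⟩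

/-- The Cartesian product of a family of graphs: two vertices are adjacent if they are adjacent in
one coordinate and agree in all the others. -/
def boxPi {ι : Type*} {V : ι → Type*} (G : ∀ i, SimpleGraph (V i)) : SimpleGraph (∀ i, V i) where
  Adj x y := ∃ i, (G i).Adj (x i) (y i) ∧ ∀ j, j ≠ i → x j = y j
  symm := ⟨fun _ _ ⟨i, h, h'⟩ => ⟨i, h.symm, fun j hj => (h' j hj).symm⟩⟩
  loopless := ⟨fun _ ⟨_, h, _⟩ => h.ne rfl⟩

/-- The grid `P_1 □ ⋯ □ P_n`, where `P_i` is the path with `m i` edges (on `m i + 1` vertices). -/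
def grid {n : ℕ} (m : Fin n → ℕ) : SimpleGraph (∀ i, Fin (m i + 1)) :=
  boxPi fun i => SimpleGraph.pathGraph (m i + 1)

/-! Write `h_H` for the vector `graphVec H`, and let `T` be a tree. Thickness of products rests on
one identity (`graphVec_boxProd_eq`): the vector of `H □ T` is the vector of `H` with every set `A`
replaced by `A × V(T)`, plus the vectors of the copies of `K₂ □ T` over the edges of `H`, plus `(deg
u - 1)` times the negated vector of the copy of `T` over each vertex `u`. If `H` is the frame of a
complex `M` and `P` is a thick complex with frame `K₂ □ T`, then running the construction of `M`
from `P` instead of the trivial complex gives a complex with frame `H □ T` whose relation contains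
all the pairs needed for the first two kinds of terms (`exists_prod`). In the third kind `deg u ≥
1`, and attaching a leaf subtracts one vector `t_{A,B}` from `h_T`, so `-h_T` is a sum of such
vectors and lies in `Q` without any relation. What is left is `K₂ □ T`. For a tree `T` with an edge
this is `T □ K₂`, and the same argument reduces it to two facts: `T` is thick, because a leaf can be
attached by reflecting an edge in one endpoint, and the four-cycle `K₂ □ K₂` is thick, by an
explicit decomposition. Grids then follow by adding one path at a time, and hypercubes are grids.
Thickness gives Sidorenko's inequality by entropy. For `G` with an edge, a reflection complex
carries a random homomorphism from its frame to `G` which is uniform on each edge of the frame and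
for which related sets are conditionally independent: each reflection is realised by a conditionally
independent copy. Let `D(S) = |S| log |V(G)|` minus the entropy of the values on `S`. Then `D`
vanishes at `∅`, is non-negative and supermodular, and is modular on related pairs, so it is
non-negative on `W_B + Q`. Applied to `h_H` this gives `D(V) ≤ |E(H)| D(e)`, where `D(e) = -log t(e,
G)` and `D(V) ≥ -log t(H, G)`. -/

namespace BHypergraph

/-! ### Reflections of complexes and their frames -/

variable {V V' : Type*}

/-- The reflection `r_{L,X}(M)` in terms of a pair of maps `V → V'`, of which the second one
matters only on `L`. -/
def reflection (M : BHypergraph V) (L X : Set V) (t₁ t₂ : V → V') : BHypergraph V' where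
  edges := {K | (∃ K₁ ∈ M.edges, K = t₁ '' K₁) ∨ (∃ K₂ ∈ M.edges, K₂ ⊆ L ∧ K = t₂ '' K₂) ∨
    ∃ K₁ ∈ M.edges, ∃ K₂ ∈ M.edges, K₂ ⊆ L ∧ X ⊆ K₁ ∧ X ⊆ K₂ ∧ K = t₁ '' K₁ ∪ t₂ '' K₂}
  rel A B := (∃ A₁ B₁, M.rel A₁ B₁ ∧ A = t₁ '' A₁ ∧ B = t₁ '' B₁) ∨
    (∃ A₂ B₂, M.rel A₂ B₂ ∧ A₂ ⊆ L ∧ B₂ ⊆ L ∧ A = t₂ '' A₂ ∧ B = t₂ '' B₂) ∨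
    ∃ K₁ ∈ M.edges, ∃ K₂ ∈ M.edges, K₂ ⊆ L ∧ X ⊆ K₁ ∧ X ⊆ K₂ ∧
      ((A = t₁ '' K₁ ∧ B = t₂ '' K₂) ∨ (A = t₂ '' K₂ ∧ B = t₁ '' K₁))
  rel_symm := by
    rintro A B (⟨A₁, B₁, h, hA, hB⟩ | ⟨A₂, B₂, h, hAL, hBL, hA, hB⟩ | ⟨K₁, h₁, K₂, h₂, hL, h, h', e⟩)
    · exact Or.inl ⟨B₁, A₁, M.rel_symm _ _ h, hB, hA⟩
    · exact Or.inr (Or.inl ⟨B₂, A₂, M.rel_symm _ _ h, hBL, hAL, hB, hA⟩)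
    · exact Or.inr (Or.inr ⟨K₁, h₁, K₂, h₂, hL, h, h', e.symm.imp And.symm And.symm⟩)

/-- `V'` is glued from `V` and a copy of `L ⊆ V` along `X ⊆ L`. -/
structure IsMirror (L X : Set V) (t₁ t₂ : V → V') : Prop where
  subset : X ⊆ L
  inj_left : Function.Injective t₁
  inj_right : Set.InjOn t₂ L
  eq_iff : ∀ v, ∀ w ∈ L, t₁ v = t₂ w ↔ v = w ∧ v ∈ X
  cover : ∀ z, (∃ v, t₁ v = z) ∨ ∃ w ∈ L, t₂ w = z

theorem exists_isMirror {L X : Set V} (hX : X ⊆ L) {τ₁ : V → V'} {τ₂ : L → V'}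
    (hτ : IsVertexGluing (Subtype.val : X → V) (Set.inclusion hX) τ₁ τ₂) :
    ∃ t₂ : V → V', (∀ w : L, τ₂ w = t₂ w) ∧ IsMirror L X τ₁ t₂ := by
  classical
  -- Off `L` the extension of `τ₂` is a default that no condition of `IsMirror` sees.
  have key : ∀ w : L, τ₂ w = (fun v => if h : v ∈ L then τ₂ ⟨v, h⟩ else τ₁ v) w := by
    rintro ⟨w, hw⟩
    simp [hw]
  generalize (fun v => if h : v ∈ L then τ₂ ⟨v, h⟩ else τ₁ v) = t₂ at key
  refine ⟨t₂, key, hX, hτ.injective_left, ?_, ?_, ?_⟩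
  · intro a ha b hb h
    rw [← key ⟨a, ha⟩, ← key ⟨b, hb⟩] at h
    exact congrArg Subtype.val (hτ.injective_right h)
  · intro v w hw
    rw [← key ⟨w, hw⟩, hτ.eq_iff]
    constructor
    · rintro ⟨f, rfl, hf⟩
      exact ⟨congrArg Subtype.val hf, f.2⟩
    · rintro ⟨rfl, h⟩
      exact ⟨⟨v, h⟩, rfl, rfl⟩
  · intro z
    have hz : z ∈ Set.range τ₁ ∪ Set.range τ₂ := hτ.cover ▸ Set.mem_univ z
    rcases hz with ⟨v, hv⟩ | ⟨w, hw⟩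
    · exact Or.inl ⟨v, hv⟩
    · exact Or.inr ⟨w, w.2, by rw [← key w, hw]⟩

theorem IsMirror.isVertexGluing {L X : Set V} {t₁ t₂ : V → V'} (h : IsMirror L X t₁ t₂) :
    IsVertexGluing (Subtype.val : X → V) (Set.inclusion h.subset) t₁ (fun w : L => t₂ w) where
  injective_left := h.inj_left
  injective_right a b hab := Subtype.ext (h.inj_right a.2 b.2 hab)
  eq_iff v w := by
    rw [h.eq_iff v w w.2]
    constructor
    · rintro ⟨rfl, hv⟩
      exact ⟨⟨_, hv⟩, rfl, rfl⟩
    · rintro ⟨f, rfl, rfl⟩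
      exact ⟨rfl, f.2⟩
  cover := by
    refine Set.eq_univ_of_forall fun z => ?_
    rcases h.cover z with ⟨v, hv⟩ | ⟨w, hw, hz⟩
    · exact Or.inl ⟨v, hv⟩
    · exact Or.inr ⟨⟨w, hw⟩, hz⟩

/-- Sets in the subtype `L` correspond to subsets of `V` contained in `L`, so the restriction of `M`
to `L` can be eliminated from the gluing. -/
theorem starGlue_induce_eq_reflection (M : BHypergraph V) {L X : Set V} (hX : X ⊆ L)
    (τ₁ : V → V') (τ₂ : L → V') (t₂ : V → V') (ht : ∀ w : L, τ₂ w = t₂ w) :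
    starGlue M (M.induce L) (Subtype.val : X → V) (Set.inclusion hX) τ₁ τ₂ =
      reflection M L X τ₁ t₂ := by
  have himg : ∀ K : Set L, τ₂ '' K = t₂ '' (Subtype.val '' K) := by
    intro K
    rw [Set.image_image]
    exact Set.image_congr fun w _ => ht w
  have hsub : ∀ K : Set L, (Subtype.val '' K : Set V) ⊆ L := by
    rintro K _ ⟨w, _, rfl⟩
    exact w.2
  have hlift : ∀ K : Set V, K ⊆ L → (Subtype.val '' (Subtype.val ⁻¹' K : Set L) : Set V) = K := by
    intro K hK
    rw [Subtype.image_preimage_coe, Set.inter_eq_right.2 hK]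
  have hr₁ : Set.range (Subtype.val : X → V) = X := Subtype.range_coe
  have hr₂ : ∀ K : Set L, Set.range (Set.inclusion hX) ⊆ K ↔ X ⊆ (Subtype.val '' K : Set V) := by
    intro K
    constructor
    · intro h x hx
      exact ⟨_, h ⟨⟨x, hx⟩, rfl⟩, rfl⟩
    · rintro h _ ⟨x, rfl⟩
      obtain ⟨w, hw, hwx⟩ := h x.2
      have : w = Set.inclusion hX x := Subtype.ext hwx
      exact this ▸ hw
  unfold starGlue reflection
  congr 1
  · ext K
    simp only [Set.mem_ofPred_eq, hr₁, hr₂, himg]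
    refine or_congr Iff.rfl (or_congr ⟨?_, ?_⟩ ⟨?_, ?_⟩)
    · rintro ⟨K₂, h, rfl⟩
      exact ⟨_, h, hsub _, rfl⟩
    · rintro ⟨K₂, h, hL, rfl⟩
      refine ⟨Subtype.val ⁻¹' K₂, ?_, by rw [hlift _ hL]⟩
      change _ ∈ M.edges
      rwa [hlift _ hL]
    · rintro ⟨K₁, h₁, K₂, h₂, hX₁, hX₂, rfl⟩
      exact ⟨_, h₁, _, h₂, hsub _, hX₁, hX₂, rfl⟩
    · rintro ⟨K₁, h₁, K₂, h₂, hL, hX₁, hX₂, rfl⟩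
      refine ⟨K₁, h₁, Subtype.val ⁻¹' K₂, ?_, hX₁, ?_, ?_⟩
      · change _ ∈ M.edges
        rwa [hlift _ hL]
      · rwa [hlift _ hL]
      · rw [hlift _ hL]
  · ext A B
    simp only [hr₁, hr₂, himg]
    refine or_congr Iff.rfl (or_congr ⟨?_, ?_⟩ ⟨?_, ?_⟩)
    · rintro ⟨A₂, B₂, h, rfl, rfl⟩
      exact ⟨_, _, h, hsub _, hsub _, rfl, rfl⟩
    · rintro ⟨A₂, B₂, h, hA, hB, rfl, rfl⟩
      refine ⟨Subtype.val ⁻¹' A₂, Subtype.val ⁻¹' B₂, ?_, by rw [hlift _ hA], by rw [hlift _ hB]⟩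
      change M.rel _ _
      rwa [hlift _ hA, hlift _ hB]
    · rintro ⟨K₁, h₁, K₂, h₂, hX₁, hX₂, h⟩
      exact ⟨_, h₁, _, h₂, hsub _, hX₁, hX₂, h⟩
    · rintro ⟨K₁, h₁, K₂, h₂, hL, hX₁, hX₂, h⟩
      refine ⟨K₁, h₁, Subtype.val ⁻¹' K₂, ?_, hX₁, ?_, ?_⟩
      · change _ ∈ M.edges
        rwa [hlift _ hL]
      · rwa [hlift _ hL]
      · rwa [hlift _ hL]

theorem IsReflectionComplex.reflection {V V' : Type} {M : BHypergraph V} {L X : Set V}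
    (hM : M.IsReflectionComplex) (hL : L ∈ M.edges) {t₁ t₂ : V → V'} (ht : IsMirror L X t₁ t₂) :
    (M.reflection L X t₁ t₂).IsReflectionComplex := by
  rw [← starGlue_induce_eq_reflection M ht.subset t₁ (fun w : L => t₂ w) t₂ fun _ => rfl]
  exact hM.reflect hL ht.subset _ _ ht.isVertexGluing

theorem IsReflectionComplex.reflection_induction
    {motive : ∀ {V : Type}, BHypergraph V → Prop} (trivial : motive trivialComplex)
    (reflection : ∀ {V V' : Type} {M : BHypergraph V} {L X : Set V} {t₁ t₂ : V → V'},
      M.IsReflectionComplex → motive M → L ∈ M.edges → IsMirror L X t₁ t₂ →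
      motive (M.reflection L X t₁ t₂))
    {V : Type} {M : BHypergraph V} (hM : M.IsReflectionComplex) : motive M := by
  induction hM with
  | trivial => exact trivial
  | reflect hM hL hX τ₁ τ₂ hτ ih =>
    obtain ⟨t₂, ht, hm⟩ := exists_isMirror hX hτ
    rw [starGlue_induce_eq_reflection _ hX τ₁ τ₂ t₂ ht]
    exact reflection hM ih hL hm

theorem IsMirror.image_union_image {L X : Set V} {t₁ t₂ : V → V'} (h : IsMirror L X t₁ t₂) :
    t₁ '' Set.univ ∪ t₂ '' L = Set.univ := by
  refine Set.eq_univ_of_forall fun z => ?_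
  rcases h.cover z with ⟨v, hv⟩ | ⟨w, hw, hz⟩
  · exact Or.inl ⟨v, trivial, hv⟩
  · exact Or.inr ⟨w, hw, hz⟩

theorem IsMirror.image_inter_image {L X : Set V} {t₁ t₂ : V → V'} (h : IsMirror L X t₁ t₂)
    {K₁ K₂ : Set V} (hL : K₂ ⊆ L) (h₁ : X ⊆ K₁) (h₂ : X ⊆ K₂) :
    t₁ '' K₁ ∩ t₂ '' K₂ = t₁ '' X := by
  ext z
  constructor
  · rintro ⟨⟨v, hv, rfl⟩, w, hw, hz⟩
    exact ⟨v, ((h.eq_iff v w (hL hw)).1 hz.symm).2, rfl⟩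
  · rintro ⟨v, hv, rfl⟩
    exact ⟨⟨v, h₁ hv, rfl⟩, v, h₂ hv, ((h.eq_iff v v (h.subset hv)).2 ⟨rfl, hv⟩).symm⟩

theorem reflection_rel_univ {M : BHypergraph V} {L X : Set V} {t₁ t₂ : V → V'}
    (hu : Set.univ ∈ M.edges) (hL : L ∈ M.edges) (ht : IsMirror L X t₁ t₂) :
    (M.reflection L X t₁ t₂).rel (t₁ '' Set.univ) (t₂ '' L) :=
  Or.inr (Or.inr ⟨_, hu, _, hL, subset_rfl, Set.subset_univ _, ht.subset, Or.inl ⟨rfl, rfl⟩⟩)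

/-- The edges `V` and `L` both contain `X` and give an edge of the second type that covers the glued
set. Hence a complex can be reflected with `L = V`, and the two whole copies are always related. -/
theorem IsReflectionComplex.univ_mem {V : Type} {M : BHypergraph V} (hM : M.IsReflectionComplex) :
    Set.univ ∈ M.edges := by
  refine hM.reflection_induction (motive := fun M => Set.univ ∈ M.edges) rfl ?_
  intro V V' M L X t₁ t₂ _ ih hL ht
  exact Or.inr (Or.inr ⟨_, ih, _, hL, subset_rfl, Set.subset_univ _, ht.subset,
    ht.image_union_image.symm⟩)

/-- This keeps edges of the second type from adding anything new to the frame. -/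
theorem IsReflectionComplex.nontrivial_of_mem {V : Type} {M : BHypergraph V}
    (hM : M.IsReflectionComplex) : ∀ K ∈ M.edges, K.Nontrivial := by
  refine hM.reflection_induction (motive := fun M => ∀ K ∈ M.edges, K.Nontrivial) ?_ ?_
  · rintro K rfl
    exact Set.nontrivial_univ
  · rintro V V' M L X t₁ t₂ _ ih hL ht K
      (⟨K₁, h₁, rfl⟩ | ⟨K₂, h₂, hL₂, rfl⟩ | ⟨K₁, h₁, K₂, h₂, hL₂, hX₁, hX₂, rfl⟩)
    · exact (ih _ h₁).image ht.inj_left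
    · exact (ih _ h₂).image_of_injOn (ht.inj_right.mono hL₂)
    · exact ((ih _ h₁).image ht.inj_left).mono Set.subset_union_left

theorem IsReflectionComplex.finite {V : Type} {M : BHypergraph V}
    (hM : M.IsReflectionComplex) : Finite V := by
  refine hM.reflection_induction (motive := fun {V} _ => Finite V) inferInstance ?_
  intro V V' M L X t₁ t₂ _ ih _ ht
  have : (Set.univ : Set V').Finite :=
    ht.image_union_image ▸ (Set.toFinite _).union (Set.toFinite _)
  exact Set.finite_univ_iff.1 this

theorem image_eq_pair {f : V → V'} {K : Set V} (hf : Set.InjOn f K) {a b : V'} (hab : a ≠ b)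
    (h : f '' K = {a, b}) : ∃ u v, u ≠ v ∧ K = {u, v} ∧ f u = a ∧ f v = b := by
  obtain ⟨u, hu, rfl⟩ : a ∈ f '' K := h ▸ Or.inl rfl
  obtain ⟨v, hv, rfl⟩ : b ∈ f '' K := h ▸ Or.inr rfl
  refine ⟨u, v, fun e => hab (e ▸ rfl), ?_, rfl, rfl⟩
  ext w
  constructor
  · intro hw
    rcases (h ▸ ⟨w, hw, rfl⟩ : f w ∈ ({f u, f v} : Set V')) with e | e
    · exact Or.inl (hf hw hu e)
    · exact Or.inr (hf hw hv e)
  · rintro (rfl | rfl)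
    exacts [hu, hv]

/-- The edges of the frame of a reflection come from the frame of the original complex. -/
theorem frame_reflection_adj {M : BHypergraph V} (hM : ∀ K ∈ M.edges, K.Nontrivial)
    {L X : Set V} {t₁ t₂ : V → V'} (ht : IsMirror L X t₁ t₂) (a b : V') :
    (M.reflection L X t₁ t₂).frame.Adj a b ↔
      (∃ u v, M.frame.Adj u v ∧ t₁ u = a ∧ t₁ v = b) ∨
        ∃ u ∈ L, ∃ v ∈ L, M.frame.Adj u v ∧ t₂ u = a ∧ t₂ v = b := by
  constructor
  · rintro ⟨hab, hK⟩
    rcases hK with ⟨K₁, h₁, e⟩ | ⟨K₂, h₂, hL₂, e⟩ | ⟨K₁, h₁, K₂, h₂, hL₂, hX₁, hX₂, e⟩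
    · obtain ⟨u, v, huv, rfl, hu, hv⟩ := image_eq_pair ht.inj_left.injOn hab e.symm
      exact Or.inl ⟨u, v, ⟨huv, h₁⟩, hu, hv⟩
    · obtain ⟨u, v, huv, rfl, hu, hv⟩ := image_eq_pair (ht.inj_right.mono hL₂) hab e.symm
      exact Or.inr ⟨u, hL₂ (Or.inl rfl), v, hL₂ (Or.inr rfl), ⟨huv, h₂⟩, hu, hv⟩
    -- An edge of the second type with two elements equals its part `t₁ '' K₁`, which already has
    -- two elements.
    · have hs : t₁ '' K₁ ⊆ {a, b} := e ▸ Set.subset_union_left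
      have hn := (hM _ h₁).image ht.inj_left
      have e' : t₁ '' K₁ = {a, b} := by
        refine hs.antisymm ?_
        obtain ⟨x, hx, y, hy, hxy⟩ := hn
        rcases hs hx with rfl | rfl <;> rcases hs hy with rfl | rfl
        · exact absurd rfl hxy
        · rintro z (rfl | rfl) <;> assumption
        · rintro z (rfl | rfl) <;> assumption
        · exact absurd rfl hxy
      obtain ⟨u, v, huv, rfl, hu, hv⟩ := image_eq_pair ht.inj_left.injOn hab e'
      exact Or.inl ⟨u, v, ⟨huv, h₁⟩, hu, hv⟩
  · rintro (⟨u, v, h, rfl, rfl⟩ | ⟨u, hu, v, hv, h, rfl, rfl⟩)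
    · exact ⟨fun e => h.1 (ht.inj_left e), Or.inl ⟨_, h.2, (Set.image_pair _ _ _).symm⟩⟩
    · refine ⟨fun e => h.1 (ht.inj_right hu hv e), Or.inr (Or.inl ⟨_, h.2, ?_, ?_⟩)⟩
      · rintro z (rfl | rfl) <;> assumption
      · exact (Set.image_pair _ _ _).symm

theorem frame_trivialComplex : trivialComplex.frame = ⊤ := by
  ext u v
  simp only [frame, trivialComplex, Set.mem_singleton_iff, SimpleGraph.top_adj, and_iff_left_iff_imp]
  intro h
  ext w
  fin_cases u <;> fin_cases v <;> fin_cases w <;> simp_all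

/-- The neighbour is required inside the edge `K` because the second copy retains only `L`, which is
itself an edge. The consequence used later is that all degrees in the frame are at least `1`. -/
theorem IsReflectionComplex.exists_adj_of_mem {V : Type} {M : BHypergraph V}
    (hM : M.IsReflectionComplex) : ∀ K ∈ M.edges, ∀ v ∈ K, ∃ u ∈ K, M.frame.Adj v u := by
  refine hM.reflection_induction
    (motive := fun M => ∀ K ∈ M.edges, ∀ v ∈ K, ∃ u ∈ K, M.frame.Adj v u) ?_ ?_
  · rintro K rfl v -
    rw [frame_trivialComplex]
    exact ⟨1 - v, Set.mem_univ _, by fin_cases v <;> simp⟩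
  · intro V V' M L X t₁ t₂ hM ih hL ht
    have h1 : ∀ K ∈ M.edges, ∀ z ∈ t₁ '' K,
        ∃ u ∈ t₁ '' K, (M.reflection L X t₁ t₂).frame.Adj z u := by
      rintro K hK _ ⟨v, hv, rfl⟩
      obtain ⟨u, hu, h⟩ := ih K hK v hv
      exact ⟨_, ⟨u, hu, rfl⟩, (frame_reflection_adj hM.nontrivial_of_mem ht _ _).2
        (Or.inl ⟨_, _, h, rfl, rfl⟩)⟩
    have h2 : ∀ K ∈ M.edges, K ⊆ L → ∀ z ∈ t₂ '' K,
        ∃ u ∈ t₂ '' K, (M.reflection L X t₁ t₂).frame.Adj z u := by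
      rintro K hK hKL _ ⟨v, hv, rfl⟩
      obtain ⟨u, hu, h⟩ := ih K hK v hv
      exact ⟨_, ⟨u, hu, rfl⟩, (frame_reflection_adj hM.nontrivial_of_mem ht _ _).2
        (Or.inr ⟨_, hKL hv, _, hKL hu, h, rfl, rfl⟩)⟩
    rintro K (⟨K₁, h₁, rfl⟩ | ⟨K₂, h₂, hL₂, rfl⟩ | ⟨K₁, h₁, K₂, h₂, hL₂, hX₁, hX₂, rfl⟩)
    · exact h1 _ h₁
    · exact h2 _ h₂ hL₂
    · rintro z (hz | hz)
      · obtain ⟨u, hu, h⟩ := h1 _ h₁ z hz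
        exact ⟨u, Or.inl hu, h⟩
      · obtain ⟨u, hu, h⟩ := h2 _ h₂ hL₂ z hz
        exact ⟨u, Or.inr hu, h⟩

theorem IsReflectionComplex.exists_adj {V : Type} {M : BHypergraph V}
    (hM : M.IsReflectionComplex) (v : V) : ∃ u, M.frame.Adj v u :=
  let ⟨u, _, h⟩ := hM.exists_adj_of_mem _ hM.univ_mem v (Set.mem_univ v)
  ⟨u, h⟩

end BHypergraph

noncomputable section

/-! ### The cone `W_b + Q_V` and its transport along maps of sets -/

section Cone

variable {V V' : Type*}

/-- `W_b + Q_V` as a cone. -/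
def thickCone (b : Set V → Set V → Prop) : Submodule NNReal (Set V → ℝ) :=
  (relSpan b).restrictScalars NNReal ⊔
    ((Submodule.span ℝ {oneAt (∅ : Set V)}).restrictScalars NNReal ⊔
      Submodule.span NNReal ({w | ∃ A B : Set V, w = tVec A B} ∪ {w | ∃ A : Set V, w = oneAt A}))

theorem mem_thickCone {b : Set V → Set V → Prop} {x : Set V → ℝ} :
    x ∈ thickCone b ↔ x ∈ (relSpan b : Set (Set V → ℝ)) + coneQ V := by
  rw [thickCone, coneQ, ← SetLike.mem_coe, Submodule.coe_sup, Submodule.coe_sup]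
  rfl

theorem thickCone_of_relSpan {b : Set V → Set V → Prop} {x : Set V → ℝ} (h : x ∈ relSpan b) :
    x ∈ thickCone b :=
  le_sup_left (a := (relSpan b).restrictScalars NNReal) h

theorem neg_tVec_mem_thickCone {b : Set V → Set V → Prop} {A B : Set V} (h : b A B) :
    -tVec A B ∈ thickCone b :=
  thickCone_of_relSpan (neg_mem (Submodule.subset_span ⟨A, B, h, rfl⟩))

theorem span_le_thickCone (b : Set V → Set V → Prop) :
    Submodule.span NNReal
      ({w | ∃ A B : Set V, w = tVec A B} ∪ {w | ∃ A : Set V, w = oneAt A}) ≤ thickCone b :=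
  le_sup_right.trans le_sup_right

theorem tVec_mem_thickCone (b : Set V → Set V → Prop) (A B : Set V) : tVec A B ∈ thickCone b :=
  span_le_thickCone b (Submodule.subset_span (Or.inl ⟨A, B, rfl⟩))

theorem oneAt_mem_thickCone (b : Set V → Set V → Prop) (A : Set V) : oneAt A ∈ thickCone b :=
  span_le_thickCone b (Submodule.subset_span (Or.inr ⟨A, rfl⟩))

theorem smul_oneAt_empty_mem_thickCone (b : Set V → Set V → Prop) (r : ℝ) :
    r • oneAt ∅ ∈ thickCone b :=
  (le_sup_left.trans le_sup_right :
    (Submodule.span ℝ {oneAt (∅ : Set V)}).restrictScalars NNReal ≤ thickCone b)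
    (Submodule.smul_mem _ r (Submodule.mem_span_singleton_self _))

theorem smul_mem_thickCone {b : Set V → Set V → Prop} {x : Set V → ℝ} (hx : x ∈ thickCone b)
    {r : ℝ} (hr : 0 ≤ r) : r • x ∈ thickCone b :=
  (thickCone b).smul_mem ⟨r, hr⟩ hx

/-- `σ` is compatible with unions, intersections and the empty set. -/
structure IsSetHom (σ : Set V → Set V') : Prop where
  union : ∀ A B, σ (A ∪ B) = σ A ∪ σ B
  inter : ∀ A B, σ (A ∩ B) = σ A ∩ σ B
  empty : σ ∅ = ∅

theorem isSetHom_image {f : V → V'} (hf : Function.Injective f) : IsSetHom (Set.image f) where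
  union := Set.image_union f
  inter _ _ := Set.image_inter hf
  empty := Set.image_empty f

theorem isSetHom_prod_univ (S : Type*) :
    IsSetHom fun A : Set V => A ×ˢ (Set.univ : Set S) where
  union _ _ := Set.union_prod
  inter _ _ := Set.inter_prod
  empty := Set.empty_prod

variable [Finite V]

/-- The linear map sending `1_S` to `1_{σ S}`. -/
def pushSet (σ : Set V → Set V') : (Set V → ℝ) →ₗ[ℝ] (Set V' → ℝ) :=
  (Pi.basisFun ℝ (Set V)).constr ℝ fun S => oneAt (σ S)

@[simp]
theorem pushSet_oneAt (σ : Set V → Set V') (S : Set V) : pushSet σ (oneAt S) = oneAt (σ S) := by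
  classical
  have : oneAt S = Pi.basisFun ℝ (Set V) S := by
    ext T
    simp [oneAt, Set.indicator_apply, Pi.single_apply]
  rw [this, pushSet, Module.Basis.constr_basis]

theorem pushSet_tVec {σ : Set V → Set V'} (hσ : IsSetHom σ) (A B : Set V) :
    pushSet σ (tVec A B) = tVec (σ A) (σ B) := by
  simp [tVec, hσ.union, hσ.inter]

/-- A map compatible with `∪`, `∩` and `∅` sends each kind of generator to a generator of the same
kind. It is applied to images under injections and to `A ↦ A × S`. -/
theorem pushSet_mem_thickCone {σ : Set V → Set V'} (hσ : IsSetHom σ)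
    {b : Set V → Set V → Prop} {b' : Set V' → Set V' → Prop}
    (hb : ∀ A B, b A B → b' (σ A) (σ B)) {x : Set V → ℝ} (hx : x ∈ thickCone b) :
    pushSet σ x ∈ thickCone b' := by
  suffices h : thickCone b ≤ (thickCone b').comap ((pushSet σ).restrictScalars NNReal) from h hx
  refine sup_le ?_ (sup_le ?_ ?_)
  · intro y hy
    refine thickCone_of_relSpan ?_
    change y ∈ (relSpan b').comap (pushSet σ)
    refine (Submodule.span_le.2 ?_ : relSpan b ≤ _) hy
    rintro _ ⟨A, B, hAB, rfl⟩
    change pushSet σ (tVec A B) ∈ relSpan b'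
    rw [pushSet_tVec hσ]
    exact Submodule.subset_span ⟨_, _, hb _ _ hAB, rfl⟩
  · intro y hy
    obtain ⟨r, rfl⟩ := Submodule.mem_span_singleton.1 hy
    change pushSet σ (r • oneAt ∅) ∈ thickCone b'
    rw [map_smul, pushSet_oneAt, hσ.empty]
    exact smul_oneAt_empty_mem_thickCone _ r
  · rw [Submodule.span_le]
    rintro _ (⟨A, B, rfl⟩ | ⟨A, rfl⟩)
    · change pushSet σ (tVec A B) ∈ thickCone b'
      rw [pushSet_tVec hσ]
      exact tVec_mem_thickCone _ _ _
    · change pushSet σ (oneAt A) ∈ thickCone b'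
      rw [pushSet_oneAt]
      exact oneAt_mem_thickCone _ _

end Cone

/-! ### The vector of a graph -/

section GraphVector

variable {V V' : Type*}

open Classical in
/-- The entries of the adjacency matrix. -/
def adjOne (H : SimpleGraph V) (u v : V) : ℝ := if H.Adj u v then 1 else 0

theorem adjOne_comm (H : SimpleGraph V) (u v : V) : adjOne H u v = adjOne H v u := by
  classical
  exact if_congr (H.adj_comm u v) rfl rfl

theorem adjOne_of_adj {H : SimpleGraph V} {u v : V} (h : H.Adj u v) : adjOne H u v = 1 := if_pos h

theorem adjOne_of_not_adj {H : SimpleGraph V} {u v : V} (h : ¬H.Adj u v) : adjOne H u v = 0 :=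
  if_neg h

theorem adjOne_nonneg (H : SimpleGraph V) (u v : V) : 0 ≤ adjOne H u v := by
  unfold adjOne
  split_ifs <;> norm_num

variable [Fintype V]

/-- The degree as a real number. -/
def degOne (H : SimpleGraph V) (u : V) : ℝ := ∑ v, adjOne H u v

open Classical in
theorem degOne_eq_degree (H : SimpleGraph V) (u : V) : degOne H u = H.degree u := by
  simp [degOne, adjOne, ← SimpleGraph.card_neighborFinset_eq_degree,
    SimpleGraph.neighborFinset_eq_filter]

theorem one_le_degOne {H : SimpleGraph V} {u : V} (h : ∃ v, H.Adj u v) : 1 ≤ degOne H u := by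
  obtain ⟨v, hv⟩ := h
  rw [← adjOne_of_adj hv]
  exact Finset.single_le_sum (f := fun v => adjOne H u v) (fun v _ => adjOne_nonneg _ _ _)
    (Finset.mem_univ v)

-- Every edge underlies exactly two darts.
open Classical in
theorem sum_edgeFinset_eq_half_sum {E : Type*} [AddCommGroup E] [Module ℝ E] (H : SimpleGraph V)
    (f : Sym2 V → E) :
    ∑ e ∈ H.edgeFinset, f e = (1 / 2 : ℝ) • ∑ u, ∑ v, adjOne H u v • f s(u, v) := by
  have h1 : ∑ d : H.Dart, f d.edge = (2 : ℝ) • ∑ e ∈ H.edgeFinset, f e := by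
    rw [← Finset.sum_fiberwise_of_maps_to (s := Finset.univ) (t := H.edgeFinset)
      (g := fun d : H.Dart => d.edge)
      (fun d _ => SimpleGraph.mem_edgeFinset.2 d.edge_mem), Finset.smul_sum]
    refine Finset.sum_congr rfl fun e he => ?_
    rw [Finset.sum_congr rfl (g := fun _ => f e) (by simp +contextual), Finset.sum_const,
      H.dart_edge_fiber_card e (SimpleGraph.mem_edgeFinset.1 he)]
    module
  have h2 : ∑ d : H.Dart, f d.edge = ∑ u, ∑ v, adjOne H u v • f s(u, v) := by
    rw [← Fintype.sum_prod_type' (f := fun u v => adjOne H u v • f s(u, v))]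
    simp only [adjOne, ite_smul, one_smul, zero_smul]
    rw [← Finset.sum_filter]
    refine Finset.sum_bij' (fun d _ => d.toProd)
      (fun p hp => ⟨p, (Finset.mem_filter.1 hp).2⟩) ?_ ?_ ?_ ?_ ?_
    · intro d _
      simp
    · simp
    · intro d _
      rfl
    · intro d _
      rfl
    · intro d _
      rfl
  rw [← h2, h1, smul_smul]
  norm_num

/-- `h_H(V(H))`, with the sum over the edges replaced by a sum over ordered pairs. -/
def graphVec (H : SimpleGraph V) : Set V → ℝ :=
  -oneAt Set.univ + (1 / 2 : ℝ) • ∑ u, ∑ v, adjOne H u v • oneAt {u, v} -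
    ∑ v, (degOne H v - 1) • oneAt {v}

theorem hVec_univ (H : SimpleGraph V) : hVec H Set.univ = graphVec H := by
  classical
  unfold hVec graphVec
  congr 1
  · congr 1
    rw [Finset.filter_true_of_mem fun e _ => Set.subset_univ _]
    -- In `hVec` the summation variable is a subset of `V`, so the edge set enters as its image in
    -- the subsets of `V`. An edge is determined by its set of endpoints, so nothing is counted
    -- differently.
    have himg : ((do let a ← H.edgeFinset; pure (a : Set V)) : Finset (Set V)) =
        H.edgeFinset.image fun e : Sym2 V => (e : Set V) := by
      ext K
      simp
    rw [himg, Finset.sum_image fun e _ e' _ h => SetLike.coe_injective h]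
    convert sum_edgeFinset_eq_half_sum H fun e => oneAt (e : Set V) using 6
    exact Sym2.coe_mk.symm
  · simp only [Set.mem_univ, Finset.filter_true, Set.inter_univ]
    refine Finset.sum_congr rfl fun v _ => ?_
    rw [degOne_eq_degree, ← SimpleGraph.card_neighborSet_eq_degree, Set.ncard_eq_toFinset_card',
      Set.toFinset_card]

theorem pushSet_graphVec {H : SimpleGraph V} (σ : Set V → Set V') :
    pushSet σ (graphVec H) =
      -oneAt (σ Set.univ) + (1 / 2 : ℝ) • ∑ u, ∑ v, adjOne H u v • oneAt (σ {u, v}) -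
        ∑ v, (degOne H v - 1) • oneAt (σ {v}) := by
  simp only [graphVec, map_sub, map_add, map_neg, map_smul, map_sum, pushSet_oneAt]

theorem pushSet_graphVec_iso [Fintype V'] {H : SimpleGraph V} {H' : SimpleGraph V'} (e : H ≃g H') :
    pushSet (Set.image e) (graphVec H) = graphVec H' := by
  have ha : ∀ u v, adjOne H u v = adjOne H' (e u) (e v) := by
    intro u v
    classical
    exact if_congr e.map_adj_iff.symm rfl rfl
  have hd : ∀ u, degOne H u = degOne H' (e u) := by
    intro u
    simp only [degOne, ha]
    exact e.toEquiv.sum_comp fun v => adjOne H' (e u) v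
  rw [pushSet_graphVec, graphVec]
  simp only [ha, hd, Set.image_pair, Set.image_singleton]
  rw [Set.image_univ_of_surjective e.surjective]
  congr 3
  · rw [← e.toEquiv.sum_comp]
    refine Finset.sum_congr rfl fun u _ => ?_
    exact e.toEquiv.sum_comp fun v => adjOne H' (e u) v • oneAt {e u, v}
  · exact e.toEquiv.sum_comp fun v => (degOne H' v - 1) • oneAt {v}

theorem BHypergraph.isThick_iff (M : BHypergraph V) :
    M.IsThick ↔ graphVec M.frame ∈ thickCone M.rel := by
  rw [BHypergraph.IsThick, hVec_univ, mem_thickCone]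

end GraphVector

/-- A thick reflection complex on `V` whose frame is exactly `H`. -/
def SimpleGraph.HasThickComplex {V : Type} [Fintype V] (H : SimpleGraph V) : Prop :=
  ∃ M : BHypergraph V, M.IsReflectionComplex ∧ M.frame = H ∧ graphVec H ∈ thickCone M.rel

/-- With `L = X = V` the second copy is glued on entirely, so the reflection just renames the
vertices. This makes thickness invariant under isomorphism at the level of exact frames. -/
theorem BHypergraph.isMirror_univ {V V' : Type*} (e : V ≃ V') :
    IsMirror (Set.univ : Set V) Set.univ e e where
  subset := subset_rfl
  inj_left := e.injective
  inj_right := e.injective.injOn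
  eq_iff v w _ := by simp
  cover z := Or.inl ⟨e.symm z, by simp⟩

theorem SimpleGraph.HasThickComplex.of_iso {V V' : Type} [Fintype V] [Fintype V']
    {H : SimpleGraph V} {H' : SimpleGraph V'} (h : H.HasThickComplex) (e : H ≃g H') :
    H'.HasThickComplex := by
  obtain ⟨M, hM, rfl, hc⟩ := h
  have hm := BHypergraph.isMirror_univ e.toEquiv
  refine ⟨_, hM.reflection hM.univ_mem hm, ?_, ?_⟩
  · ext a b
    rw [BHypergraph.frame_reflection_adj hM.nontrivial_of_mem hm]
    constructor
    · rintro (⟨u, v, h, rfl, rfl⟩ | ⟨u, -, v, -, h, rfl, rfl⟩) <;> exact e.map_adj_iff.2 h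
    · intro h
      exact Or.inl ⟨e.symm a, e.symm b, e.symm.map_adj_iff.2 h, e.apply_symm_apply a,
        e.apply_symm_apply b⟩
  · rw [← pushSet_graphVec_iso e]
    exact pushSet_mem_thickCone (isSetHom_image e.injective)
      (fun A B h => Or.inl ⟨A, B, h, rfl, rfl⟩) hc

theorem SimpleGraph.HasThickComplex.isThick {V : Type*} {W : Type} [Fintype W]
    {H : SimpleGraph V} {H' : SimpleGraph W} (h : H'.HasThickComplex) (e : H ≃g H') :
    H.IsThick := by
  obtain ⟨M, hM, rfl, hc⟩ := h
  exact ⟨W, inferInstance, M, hM, M.isThick_iff.2 hc, ⟨e⟩⟩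

theorem SimpleGraph.IsThick.exists_hasThickComplex {V : Type*} {H : SimpleGraph V}
    (h : H.IsThick) : ∃ (W : Type) (_ : Fintype W) (H' : SimpleGraph W),
      H'.HasThickComplex ∧ Nonempty (H ≃g H') := by
  obtain ⟨W, _, M, hM, hc, e⟩ := h
  exact ⟨W, inferInstance, M.frame, ⟨M, hM, rfl, M.isThick_iff.1 hc⟩, e⟩

end

noncomputable section

/-! ### Complexes on products -/

namespace BHypergraph

theorem IsMirror.prodMap_id {V V' : Type*} (S : Type*) {L X : Set V} {t₁ t₂ : V → V'}
    (h : IsMirror L X t₁ t₂) :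
    IsMirror (L ×ˢ (Set.univ : Set S)) (X ×ˢ Set.univ) (Prod.map t₁ id) (Prod.map t₂ id) where
  subset := Set.prod_mono_left h.subset
  inj_left := h.inj_left.prodMap Function.injective_id
  inj_right := by
    rintro ⟨u, x⟩ hu ⟨v, y⟩ hv e
    obtain ⟨e₁, e₂⟩ := Prod.mk.inj e
    exact Prod.ext (h.inj_right hu.1 hv.1 e₁) e₂
  eq_iff := by
    rintro ⟨v, x⟩ ⟨w, y⟩ hw
    have := h.eq_iff v w hw.1
    simp only [Prod.map_apply, id_eq, Prod.mk.injEq, this, Set.mem_prod, Set.mem_univ, and_true]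
    tauto
  cover := by
    rintro ⟨z, x⟩
    rcases h.cover z with ⟨v, rfl⟩ | ⟨w, hw, rfl⟩
    · exact Or.inl ⟨(v, x), rfl⟩
    · exact Or.inr ⟨(w, x), ⟨hw, trivial⟩, rfl⟩

theorem image_prod_univ {V V' : Type*} (S : Type*) (t : V → V') (K : Set V) :
    (t '' K) ×ˢ (Set.univ : Set S) = Prod.map t id '' (K ×ˢ Set.univ) := by
  rw [Set.prodMap_image_prod, Set.image_id]

/-- Replacing the trivial complex by `P` in the construction of `M` gives a complex on `V × S`. -/
theorem IsReflectionComplex.exists_prod {S : Type} {T : SimpleGraph S}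
    {P : BHypergraph (Fin 2 × S)} (hP : P.IsReflectionComplex)
    (hPT : P.frame = SimpleGraph.boxProd ⊤ T) {V : Type} {M : BHypergraph V}
    (hM : M.IsReflectionComplex) :
    ∃ M' : BHypergraph (V × S), M'.IsReflectionComplex ∧
      M'.frame = SimpleGraph.boxProd M.frame T ∧
      (∀ K ∈ M.edges, K ×ˢ Set.univ ∈ M'.edges) ∧
      (∀ A B, M.rel A B → M'.rel (A ×ˢ Set.univ) (B ×ˢ Set.univ)) ∧
      ∀ u v, M.frame.Adj u v → ∃ i : Fin 2 → V, Function.Injective i ∧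
        ((i 0 = u ∧ i 1 = v) ∨ (i 0 = v ∧ i 1 = u)) ∧
        ∀ A B, P.rel A B → M'.rel (Prod.map i id '' A) (Prod.map i id '' B) := by
  refine hM.reflection_induction (motive := fun {V} M => ∃ M' : BHypergraph (V × S),
    M'.IsReflectionComplex ∧ M'.frame = SimpleGraph.boxProd M.frame T ∧
      (∀ K ∈ M.edges, K ×ˢ Set.univ ∈ M'.edges) ∧
      (∀ A B, M.rel A B → M'.rel (A ×ˢ Set.univ) (B ×ˢ Set.univ)) ∧
      ∀ u v, M.frame.Adj u v → ∃ i : Fin 2 → V, Function.Injective i ∧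
        ((i 0 = u ∧ i 1 = v) ∨ (i 0 = v ∧ i 1 = u)) ∧
        ∀ A B, P.rel A B → M'.rel (Prod.map i id '' A) (Prod.map i id '' B)) ?_ ?_
  · refine ⟨P, hP, by rw [hPT, frame_trivialComplex], ?_, fun _ _ h => h.elim, ?_⟩
    · rintro K rfl
      rw [Set.univ_prod_univ]
      exact hP.univ_mem
    · intro u v huv
      refine ⟨id, Function.injective_id, ?_, fun A B h => by simpa using h⟩
      have := huv.ne
      fin_cases u <;> fin_cases v <;> simp at this ⊢
  · rintro V V' M L X t₁ t₂ hM ⟨M', hM', hf, he, hr, hi⟩ hL ht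
    -- The reflection of `M` in `L`, `X` is mirrored by the reflection of `M'` in `L × S`, `X × S`;
    -- the third invariant ensures that `L × S` is an edge.
    have ht' := ht.prodMap_id S
    refine ⟨_, hM'.reflection (he _ hL) ht', ?_, ?_, ?_, ?_⟩
    · ext ⟨a, x⟩ ⟨b, y⟩
      rw [frame_reflection_adj hM'.nontrivial_of_mem ht', SimpleGraph.boxProd_adj,
        frame_reflection_adj hM.nontrivial_of_mem ht]
      simp only [hf, Prod.exists, SimpleGraph.boxProd_adj, Prod.map_apply, id_eq, Prod.mk.injEq,
        Set.mem_prod, Set.mem_univ, and_true]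
      constructor
      · rintro (⟨u, x', v, y', ⟨h, rfl⟩ | ⟨h, rfl⟩, ⟨rfl, rfl⟩, rfl, rfl⟩ |
          ⟨u, x', hu, v, y', hv, ⟨h, rfl⟩ | ⟨h, rfl⟩, ⟨rfl, rfl⟩, rfl, rfl⟩)
        · exact Or.inl ⟨Or.inl ⟨u, v, h, rfl, rfl⟩, rfl⟩
        · exact Or.inr ⟨h, rfl⟩
        · exact Or.inl ⟨Or.inr ⟨u, hu, v, hv, h, rfl, rfl⟩, rfl⟩
        · exact Or.inr ⟨h, rfl⟩
      · rintro (⟨⟨u, v, h, rfl, rfl⟩ | ⟨u, hu, v, hv, h, rfl, rfl⟩, rfl⟩ | ⟨h, rfl⟩)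
        · exact Or.inl ⟨u, x, v, x, Or.inl ⟨h, rfl⟩, ⟨rfl, rfl⟩, rfl, rfl⟩
        · exact Or.inr ⟨u, x, hu, v, x, hv, Or.inl ⟨h, rfl⟩, ⟨rfl, rfl⟩, rfl, rfl⟩
        -- An edge of the fibre over `a` exists already over a preimage of `a`, in whichever copy
        -- covers `a`.
        · rcases ht.cover a with ⟨u, rfl⟩ | ⟨u, hu, rfl⟩
          · exact Or.inl ⟨u, x, u, y, Or.inr ⟨h, rfl⟩, ⟨rfl, rfl⟩, rfl, rfl⟩
          · exact Or.inr ⟨u, x, hu, u, y, hu, Or.inr ⟨h, rfl⟩, ⟨rfl, rfl⟩, rfl, rfl⟩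
    · rintro K (⟨K₁, h₁, rfl⟩ | ⟨K₂, h₂, hL₂, rfl⟩ | ⟨K₁, h₁, K₂, h₂, hL₂, hX₁, hX₂, rfl⟩)
      · exact Or.inl ⟨_, he _ h₁, image_prod_univ S _ _⟩
      · exact Or.inr (Or.inl ⟨_, he _ h₂, Set.prod_mono_left hL₂, image_prod_univ S _ _⟩)
      · refine Or.inr (Or.inr ⟨_, he _ h₁, _, he _ h₂, Set.prod_mono_left hL₂,
          Set.prod_mono_left hX₁, Set.prod_mono_left hX₂, ?_⟩)
        rw [Set.union_prod, image_prod_univ, image_prod_univ]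
    · rintro A B (⟨A₁, B₁, h, rfl, rfl⟩ | ⟨A₂, B₂, h, hA, hB, rfl, rfl⟩ |
        ⟨K₁, h₁, K₂, h₂, hL₂, hX₁, hX₂, h⟩)
      · exact Or.inl ⟨_, _, hr _ _ h, image_prod_univ S _ _, image_prod_univ S _ _⟩
      · exact Or.inr (Or.inl ⟨_, _, hr _ _ h, Set.prod_mono_left hA, Set.prod_mono_left hB,
          image_prod_univ S _ _, image_prod_univ S _ _⟩)
      · refine Or.inr (Or.inr ⟨_, he _ h₁, _, he _ h₂, Set.prod_mono_left hL₂,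
          Set.prod_mono_left hX₁, Set.prod_mono_left hX₂, ?_⟩)
        rcases h with ⟨rfl, rfl⟩ | ⟨rfl, rfl⟩
        · exact Or.inl ⟨image_prod_univ S _ _, image_prod_univ S _ _⟩
        · exact Or.inr ⟨image_prod_univ S _ _, image_prod_univ S _ _⟩
    · intro a b hab
      have hcomp : ∀ (t : V → V') (i : Fin 2 → V) (A : Set (Fin 2 × S)),
          Prod.map (t ∘ i) id '' A = Prod.map t id '' (Prod.map i id '' A) := by
        intro t i A
        rw [Set.image_image]
        rfl
      rcases (frame_reflection_adj hM.nontrivial_of_mem ht _ _).1 hab with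
        ⟨u, v, h, rfl, rfl⟩ | ⟨u, hu, v, hv, h, rfl, rfl⟩
      · obtain ⟨i, hinj, hi', hrel⟩ := hi u v h
        refine ⟨t₁ ∘ i, ht.inj_left.comp hinj, ?_, ?_⟩
        · rcases hi' with ⟨rfl, rfl⟩ | ⟨rfl, rfl⟩
          exacts [Or.inl ⟨rfl, rfl⟩, Or.inr ⟨rfl, rfl⟩]
        · intro A B hAB
          rw [hcomp, hcomp]
          exact Or.inl ⟨_, _, hrel _ _ hAB, rfl, rfl⟩
      · obtain ⟨i, hinj, hi', hrel⟩ := hi u v h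
        -- Both ends of the edge lie in `L`, so the copy of `P` above it lies in `L × S` and its
        -- relation survives in the second copy.
        have hiL : ∀ j, i j ∈ L := by
          rcases hi' with ⟨rfl, rfl⟩ | ⟨rfl, rfl⟩ <;> intro j <;> fin_cases j <;> assumption
        have hsub : ∀ A : Set (Fin 2 × S), Prod.map i id '' A ⊆ L ×ˢ Set.univ := by
          rintro A _ ⟨p, _, rfl⟩
          exact ⟨hiL _, Set.mem_univ _⟩
        refine ⟨t₂ ∘ i, fun j k e => hinj (ht.inj_right (hiL j) (hiL k) e), ?_, ?_⟩
        · rcases hi' with ⟨rfl, rfl⟩ | ⟨rfl, rfl⟩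
          exacts [Or.inl ⟨rfl, rfl⟩, Or.inr ⟨rfl, rfl⟩]
        · intro A B hAB
          rw [hcomp, hcomp]
          exact Or.inr (Or.inl ⟨_, _, hrel _ _ hAB, hsub _, hsub _, rfl, rfl⟩)

end BHypergraph

/-! ### The vector of a Cartesian product -/

section Product

variable {V S : Type*} [Fintype S]

section

variable [Fintype V]

theorem sum_adjOne_boxProd_smul {E : Type*} [AddCommGroup E] [Module ℝ E] (H : SimpleGraph V)
    (T : SimpleGraph S) (f : V × S → E) (u : V) (x : S) :
    ∑ q, adjOne (SimpleGraph.boxProd H T) (u, x) q • f q =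
      ∑ v, adjOne H u v • f (v, x) + ∑ y, adjOne T x y • f (u, y) := by
  classical
  have h : ∀ v y, adjOne (SimpleGraph.boxProd H T) (u, x) (v, y) =
      (if x = y then adjOne H u v else 0) + if u = v then adjOne T x y else 0 := by
    intro v y
    have h1 : u = v → ¬H.Adj u v := fun e h => h.ne e
    have h2 : x = y → ¬T.Adj x y := fun e h => h.ne e
    simp only [adjOne, SimpleGraph.boxProd_adj]
    by_cases hx : x = y <;> by_cases hu : u = v <;> simp_all
  rw [Fintype.sum_prod_type]
  simp only [h, add_smul, Finset.sum_add_distrib, ite_smul, zero_smul, Finset.sum_ite_eq,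
    Finset.mem_univ, if_true]
  congr 1
  rw [Finset.sum_comm]
  simp

theorem degOne_boxProd (H : SimpleGraph V) (T : SimpleGraph S) (u : V) (x : S) :
    degOne (SimpleGraph.boxProd H T) (u, x) = degOne H u + degOne T x := by
  have := sum_adjOne_boxProd_smul H T (fun _ => (1 : ℝ)) u x
  simpa only [degOne, smul_eq_mul, mul_one] using this

theorem sum_sum_adjOne_boxProd_smul {E : Type*} [AddCommGroup E] [Module ℝ E] (H : SimpleGraph V)
    (T : SimpleGraph S) (f : V × S → V × S → E) :
    ∑ p, ∑ q, adjOne (SimpleGraph.boxProd H T) p q • f p q =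
      ∑ u, ∑ v, adjOne H u v • ∑ x, f (u, x) (v, x) +
        ∑ u, ∑ x, ∑ y, adjOne T x y • f (u, x) (u, y) := by
  rw [Fintype.sum_prod_type]
  simp only [sum_adjOne_boxProd_smul, Finset.sum_add_distrib, Finset.smul_sum]
  congr 1
  refine Finset.sum_congr rfl fun u _ => ?_
  rw [Finset.sum_comm]

/-- The sum over the edges of the copy `{u} × T` of `T`. -/
def sliceEdges (T : SimpleGraph S) (u : V) : Set (V × S) → ℝ :=
  (1 / 2 : ℝ) • ∑ x, ∑ y, adjOne T x y • oneAt {(u, x), (u, y)}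

/-- The degree-weighted sum over the vertices of the copy `{u} × T` of `T`. -/
def sliceDeg (T : SimpleGraph S) (u : V) : Set (V × S) → ℝ :=
  ∑ x, degOne T x • oneAt {(u, x)}

/-- The sum over the vertices of the copy `{u} × T` of `T`. -/
def sliceVerts (S : Type*) [Fintype S] {V : Type*} (u : V) : Set (V × S) → ℝ :=
  ∑ x, oneAt {(u, x)}

/-- The sum over the edges joining the copies `{u} × T` and `{v} × T` of `T`. -/
def rungs (S : Type*) [Fintype S] {V : Type*} (u v : V) : Set (V × S) → ℝ :=
  ∑ x, oneAt {(u, x), (v, x)}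

theorem rungs_comm (S : Type*) [Fintype S] {V : Type*} (u v : V) : rungs S u v = rungs S v u :=
  Finset.sum_congr rfl fun x _ => by rw [Set.pair_comm]

theorem graphVec_boxProd (H : SimpleGraph V) (T : SimpleGraph S) :
    graphVec (SimpleGraph.boxProd H T) =
      -oneAt Set.univ + (1 / 2 : ℝ) • ∑ u, ∑ v, adjOne H u v • rungs S u v +
        ∑ u, (sliceEdges T u - sliceDeg T u - (degOne H u - 1) • sliceVerts S u) := by
  rw [graphVec, sum_sum_adjOne_boxProd_smul, Fintype.sum_prod_type, smul_add]
  simp only [degOne_boxProd]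
  have h1 : ∀ u, ∑ x, (degOne H u + degOne T x - 1) • oneAt {(u, x)} =
      sliceDeg T u + (degOne H u - 1) • sliceVerts S u := by
    intro u
    rw [sliceDeg, sliceVerts, Finset.smul_sum, ← Finset.sum_add_distrib]
    refine Finset.sum_congr rfl fun x _ => ?_
    module
  simp only [h1, Finset.sum_add_distrib, Finset.sum_sub_distrib, rungs, sliceEdges,
    Finset.smul_sum]
  abel

end

/-- Both vertices of `K₂` have degree `1`, so no `sliceVerts` terms remain. The result is the
summand that an edge of `H` contributes to the decomposition of `H □ T`. -/
theorem pushSet_prodMap_graphVec (T : SimpleGraph S) (i : Fin 2 → V) :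
    pushSet (Set.image (Prod.map i id)) (graphVec (SimpleGraph.boxProd ⊤ T)) =
      -oneAt (Set.image (Prod.map i id) Set.univ) + rungs S (i 0) (i 1) +
        (sliceEdges T (i 0) + sliceEdges T (i 1)) - (sliceDeg T (i 0) + sliceDeg T (i 1)) := by
  have ha : adjOne (⊤ : SimpleGraph (Fin 2)) 0 1 = 1 := adjOne_of_adj (by simp)
  have ha' : adjOne (⊤ : SimpleGraph (Fin 2)) 1 0 = 1 := adjOne_of_adj (by simp)
  have hb : ∀ j, adjOne (⊤ : SimpleGraph (Fin 2)) j j = 0 := fun j => adjOne_of_not_adj (by simp)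
  have hd : ∀ j, degOne (⊤ : SimpleGraph (Fin 2)) j = 1 := by
    intro j
    fin_cases j <;> simp [degOne, ha, ha', hb]
  rw [graphVec_boxProd]
  simp only [hd, sub_self, zero_smul, sub_zero, Fin.sum_univ_two, hb, ha, ha', one_smul, zero_add,
    add_zero, map_add, map_sub, map_neg, map_smul, pushSet_oneAt]
  have h1 : ∀ j k, pushSet (Set.image (Prod.map i id)) (rungs S j k) = rungs S (i j) (i k) := by
    intro j k
    simp [rungs, map_sum, Set.image_pair]
  have h2 : ∀ j, pushSet (Set.image (Prod.map i id)) (sliceEdges T j) = sliceEdges T (i j) := by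
    intro j
    simp [sliceEdges, map_sum, Set.image_pair]
  have h3 : ∀ j, pushSet (Set.image (Prod.map i id)) (sliceDeg T j) = sliceDeg T (i j) := by
    intro j
    simp [sliceDeg, map_sum]
  rw [h1, h1, h2, h2, h3, h3, rungs_comm S (i 1)]
  module

theorem pushSet_mk_graphVec (T : SimpleGraph S) (u : V) :
    pushSet (Set.image (Prod.mk u)) (graphVec T) =
      -oneAt ({u} ×ˢ Set.univ) + sliceEdges T u - sliceDeg T u + sliceVerts S u := by
  rw [pushSet_graphVec, Set.singleton_prod]
  simp only [Set.image_pair, Set.image_singleton, sliceEdges, sliceDeg, sliceVerts, sub_smul,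
    one_smul, Finset.sum_sub_distrib]
  abel

variable [Fintype V]

theorem half_sum_adjOne_smul_add {E : Type*} [AddCommGroup E] [Module ℝ E] (H : SimpleGraph V)
    (f : V → E) :
    (1 / 2 : ℝ) • ∑ u, ∑ v, adjOne H u v • (f u + f v) = ∑ u, degOne H u • f u := by
  have h1 : ∑ u, ∑ v, adjOne H u v • f u = ∑ u, degOne H u • f u := by
    simp only [degOne, Finset.sum_smul]
  have h2 : ∑ u, ∑ v, adjOne H u v • f v = ∑ u, degOne H u • f u := by
    rw [← h1, Finset.sum_comm]
    simp only [adjOne_comm]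
  simp only [smul_add, Finset.sum_add_distrib, h1, h2]
  module

/-- The decomposition of the vector of `H □ T` into the vectors of `H`, of the products of the edges
of `H` with `T`, and of the copies of `T`. -/
theorem graphVec_boxProd_eq (H : SimpleGraph V) (T : SimpleGraph S) :
    graphVec (SimpleGraph.boxProd H T) =
      pushSet (fun A => A ×ˢ Set.univ) (graphVec H) +
        (1 / 2 : ℝ) • ∑ u, ∑ v, adjOne H u v • (-oneAt ({u, v} ×ˢ Set.univ) + rungs S u v +
          (sliceEdges T u + sliceEdges T v) - (sliceDeg T u + sliceDeg T v)) +
        ∑ u, (degOne H u - 1) • -pushSet (Set.image (Prod.mk u)) (graphVec T) := by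
  have h := half_sum_adjOne_smul_add H fun u => sliceEdges T u - sliceDeg T u
  have h' : ∀ u v, adjOne H u v • (-oneAt ({u, v} ×ˢ Set.univ) + rungs S u v +
      (sliceEdges T u + sliceEdges T v) - (sliceDeg T u + sliceDeg T v)) =
      -(adjOne H u v • oneAt ({u, v} ×ˢ Set.univ)) + adjOne H u v • rungs S u v +
        adjOne H u v • ((sliceEdges T u - sliceDeg T u) + (sliceEdges T v - sliceDeg T v)) := by
    intro u v
    module
  have hsum : (1 / 2 : ℝ) • ∑ u, ∑ v, adjOne H u v • (-oneAt ({u, v} ×ˢ Set.univ) + rungs S u v +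
      (sliceEdges T u + sliceEdges T v) - (sliceDeg T u + sliceDeg T v)) =
      -((1 / 2 : ℝ) • ∑ u, ∑ v, adjOne H u v • oneAt ({u, v} ×ˢ Set.univ)) +
        (1 / 2 : ℝ) • ∑ u, ∑ v, adjOne H u v • rungs S u v +
          ∑ u, degOne H u • (sliceEdges T u - sliceDeg T u) := by
    rw [← h]
    simp only [h']
    simp only [Finset.sum_add_distrib, Finset.sum_neg_distrib]
    module
  rw [hsum, graphVec_boxProd, pushSet_graphVec, Set.univ_prod_univ]
  simp only [pushSet_mk_graphVec]
  -- The copy of `T` over `u` occurs in `deg u` of the products over edges, and `deg u - 1` of these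
  -- occurrences are removed. The terms `1_{{u} × S}` so created cancel the vertex terms of the
  -- transported vector of `H`.
  have hs : ∀ u, sliceEdges T u - sliceDeg T u - (degOne H u - 1) • sliceVerts S u =
      -((degOne H u - 1) • oneAt ({u} ×ˢ Set.univ)) + degOne H u • (sliceEdges T u - sliceDeg T u) -
        (degOne H u - 1) •
          (-oneAt ({u} ×ˢ Set.univ) + sliceEdges T u - sliceDeg T u + sliceVerts S u) := by
    intro u
    module
  simp only [hs, Finset.sum_add_distrib, Finset.sum_sub_distrib, Finset.sum_neg_distrib, smul_neg]
  module

end Product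

/-- If `K₂ □ T` has a thick complex, then so does `H □ T` for each `H` with a thick complex. -/
theorem SimpleGraph.HasThickComplex.boxProd {V S : Type} [Fintype V] [Fintype S]
    {H : SimpleGraph V} (hH : H.HasThickComplex) {T : SimpleGraph S}
    (hT : -graphVec T ∈ thickCone fun _ _ => False)
    (hP : (SimpleGraph.boxProd (⊤ : SimpleGraph (Fin 2)) T).HasThickComplex) :
    (SimpleGraph.boxProd H T).HasThickComplex := by
  obtain ⟨M, hM, rfl, hc⟩ := hH
  obtain ⟨P, hP, hPT, hPc⟩ := hP
  obtain ⟨M', hM', hf, -, hr, hi⟩ := hP.exists_prod hPT hM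
  refine ⟨M', hM', hf, ?_⟩
  rw [graphVec_boxProd_eq]
  refine add_mem (add_mem ?_ ?_) ?_
  · exact pushSet_mem_thickCone (isSetHom_prod_univ S) hr hc
  · refine smul_mem_thickCone (sum_mem fun u _ => sum_mem fun v _ => ?_) (by norm_num)
    by_cases huv : M.frame.Adj u v
    · refine smul_mem_thickCone ?_ (adjOne_nonneg _ _ _)
      -- The summand is the transported vector of the copy of `P` over the edge `uv`.
      obtain ⟨i, hinj, hi', hrel⟩ := hi u v huv
      have := pushSet_mem_thickCone (isSetHom_image (hinj.prodMap Function.injective_id)) hrel hPc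
      rw [pushSet_prodMap_graphVec, ← Set.univ_prod_univ, ← BHypergraph.image_prod_univ] at this
      have huniv : i '' Set.univ = {i 0, i 1} := by
        ext w
        simp [Fin.exists_fin_two, eq_comm]
      rw [huniv] at this
      rcases hi' with ⟨rfl, rfl⟩ | ⟨rfl, rfl⟩
      · exact this
      · rw [Set.pair_comm (i 1), add_comm (sliceEdges T (i 1)), add_comm (sliceDeg T (i 1)),
          rungs_comm]
        exact this
    · rw [adjOne_of_not_adj huv, zero_smul]
      exact zero_mem _
  · refine sum_mem fun u _ => smul_mem_thickCone ?_ ?_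
    · rw [← map_neg]
      exact pushSet_mem_thickCone (isSetHom_image (Prod.mk_right_injective u))
        (fun _ _ h => h.elim) hT
    · exact sub_nonneg.2 (one_le_degOne (hM.exists_adj u))

end

noncomputable section

/-! ### Trees and the four-cycle -/

section Leaf

/-- The graph obtained from `T` by joining a new vertex to `u`. -/
def addLeaf {V : Type*} (T : SimpleGraph V) (u : V) : SimpleGraph (Option V) where
  Adj a b := (∃ v w, a = some v ∧ b = some w ∧ T.Adj v w) ∨ (a = some u ∧ b = none) ∨
    (a = none ∧ b = some u)
  symm := ⟨by
    rintro a b (⟨v, w, h₁, h₂, h⟩ | h | h)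
    exacts [Or.inl ⟨w, v, h₂, h₁, h.symm⟩, Or.inr (Or.inr h.symm), Or.inr (Or.inl h.symm)]⟩
  loopless := ⟨by
    rintro a (⟨v, w, h₁, h₂, h⟩ | h | h)
    · exact h.ne (Option.some_injective _ (h₁.symm.trans h₂))
    · exact Option.some_ne_none _ (h.1.symm.trans h.2)
    · exact Option.some_ne_none _ (h.2.symm.trans h.1)⟩

variable {V : Type*} {T : SimpleGraph V} {u : V}

@[simp]
theorem addLeaf_some_some {v w : V} : (addLeaf T u).Adj (some v) (some w) ↔ T.Adj v w := by
  simp [addLeaf]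

@[simp]
theorem addLeaf_some_none {v : V} : (addLeaf T u).Adj (some v) none ↔ v = u := by
  simp [addLeaf]

@[simp]
theorem addLeaf_none_some {v : V} : (addLeaf T u).Adj none (some v) ↔ v = u := by
  simp [addLeaf]

/-- The old vertex set and the new edge cover everything and meet in `u`. The new edge raises the
degree of `u` by one, while the leaf has degree `1` and contributes no vertex term; the difference
is therefore exactly `-t`. -/
theorem graphVec_addLeaf [Fintype V] :
    graphVec (addLeaf T u) = pushSet (Set.image some) (graphVec T) +
      -tVec (some '' Set.univ) ({some u, none} : Set (Option V)) := by
  classical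
  have h1 : ∀ v w, adjOne (addLeaf T u) (some v) (some w) = adjOne T v w := by
    intro v w
    simp [adjOne]
  have h2 : ∀ v, adjOne (addLeaf T u) (some v) none = if v = u then 1 else 0 := by
    intro v
    simp [adjOne]
  have h3 : ∀ v, adjOne (addLeaf T u) none (some v) = if v = u then 1 else 0 := by
    intro v
    simp [adjOne]
  have h4 : adjOne (addLeaf T u) none none = 0 := adjOne_of_not_adj (SimpleGraph.irrefl _)
  have h5 : ∀ v, degOne (addLeaf T u) (some v) = (if v = u then 1 else 0) + degOne T v := by
    intro v
    simp [degOne, Fintype.sum_option, h1, h2]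
  have h6 : degOne (addLeaf T u) none = 1 := by
    simp [degOne, Fintype.sum_option, h3, h4]
  have h7 : (some '' Set.univ ∪ {some u, none} : Set (Option V)) = Set.univ := by
    ext (_ | v) <;> simp
  have h8 : (some '' Set.univ ∩ {some u, none} : Set (Option V)) = {some u} := by
    ext (_ | v) <;> simp
  rw [pushSet_graphVec, graphVec, tVec, h7, h8]
  simp only [Fintype.sum_option, h1, h2, h3, h4, h5, h6, zero_smul, zero_add, ite_smul, one_smul,
    Finset.sum_ite_eq', Finset.mem_univ, if_true, sub_self, Finset.sum_add_distrib, add_sub_assoc,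
    add_smul, Set.image_pair, Set.image_singleton, Set.pair_comm none]
  module

end Leaf

theorem graphVec_of_unique {V : Type*} [Fintype V] [Nonempty V] [Subsingleton V]
    (H : SimpleGraph V) : graphVec H = 0 := by
  obtain ⟨v⟩ := ‹Nonempty V›
  have ha : ∀ u w, adjOne H u w = 0 := fun u w =>
    adjOne_of_not_adj fun h => h.ne (Subsingleton.elim u w)
  have hu : (Set.univ : Set V) = {v} := Set.eq_singleton_iff_unique_mem.2
    ⟨trivial, fun w _ => Subsingleton.elim w v⟩
  rw [graphVec, hu]
  simp only [degOne, ha, zero_smul, Finset.sum_const_zero, smul_zero]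
  rw [Fintype.sum_subsingleton _ v]
  module

theorem graphVec_top_fin_two : graphVec (⊤ : SimpleGraph (Fin 2)) = 0 := by
  have hu : (Set.univ : Set (Fin 2)) = {0, 1} := by
    ext i
    fin_cases i <;> simp
  rw [graphVec, hu]
  simp only [degOne, Fin.sum_univ_two, adjOne, SimpleGraph.top_adj, Set.pair_comm (1 : Fin 2)]
  norm_num
  module

theorem hasThickComplex_top_fin_two : (⊤ : SimpleGraph (Fin 2)).HasThickComplex :=
  ⟨_, .trivial, BHypergraph.frame_trivialComplex, by rw [graphVec_top_fin_two]; exact zero_mem _⟩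

/-- Reflecting an edge `{u, w}` in `X = {u}` adds a single vertex, the copy of `w`, joined to `u`.
The old vertex set and the new edge become related, so `-t` is available in `W_B`. -/
theorem SimpleGraph.HasThickComplex.addLeaf {V : Type} [Fintype V] {T : SimpleGraph V}
    (h : T.HasThickComplex) (u : V) : (addLeaf T u).HasThickComplex := by
  classical
  obtain ⟨M, hM, rfl, hc⟩ := h
  obtain ⟨w, hw⟩ := hM.exists_adj u
  have hwu : w ≠ u := hw.1.symm
  -- Only the values at `u` and `w` matter.
  set t : V → Option V := fun v => if v = u then some u else none with ht
  have htu : t u = some u := if_pos rfl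
  have htw : t w = none := if_neg hwu
  have hm : BHypergraph.IsMirror {u, w} {u} some t :=
    { subset := by simp
      inj_left := Option.some_injective V
      inj_right := by
        rintro a (rfl | rfl) b (rfl | rfl) hab <;> simp_all
      eq_iff := by
        rintro v b (rfl | rfl)
        · rw [htu]
          simp
        · rw [htw]
          simp only [reduceCtorEq, Set.mem_singleton_iff, false_iff, not_and]
          rintro rfl
          exact hwu
      cover := by
        rintro (_ | v)
        · exact Or.inr ⟨w, Or.inr rfl, htw⟩
        · exact Or.inl ⟨v, rfl⟩ }
  refine ⟨_, hM.reflection hw.2 hm, ?_, ?_⟩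
  · ext a b
    rw [BHypergraph.frame_reflection_adj hM.nontrivial_of_mem hm]
    constructor
    · rintro (⟨v, v', h, rfl, rfl⟩ | ⟨v, (rfl | rfl), v', (rfl | rfl), h, rfl, rfl⟩)
      · exact addLeaf_some_some.2 h
      · exact absurd rfl h.ne
      · rw [htu, htw]
        exact addLeaf_some_none.2 rfl
      · rw [htu, htw]
        exact addLeaf_none_some.2 rfl
      · exact absurd rfl h.ne
    · rintro (⟨v, v', rfl, rfl, h⟩ | ⟨rfl, rfl⟩ | ⟨rfl, rfl⟩)
      · exact Or.inl ⟨v, v', h, rfl, rfl⟩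
      · exact Or.inr ⟨u, Or.inl rfl, w, Or.inr rfl, hw, htu, htw⟩
      · exact Or.inr ⟨w, Or.inr rfl, u, Or.inl rfl, hw.symm, htw, htu⟩
  · rw [graphVec_addLeaf]
    refine add_mem ?_ (neg_tVec_mem_thickCone ?_)
    · exact pushSet_mem_thickCone (isSetHom_image (Option.some_injective V))
        (fun A B h => Or.inl ⟨A, B, h, rfl, rfl⟩) hc
    · have := BHypergraph.reflection_rel_univ hM.univ_mem hw.2 hm
      rwa [Set.image_pair, htu, htw] at this

/-- The properties of trees that enter into the product construction. -/
structure SimpleGraph.IsTreeLike {V : Type} [Fintype V] (T : SimpleGraph V) : Prop where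
  nonempty : Nonempty V
  neg_mem : -graphVec T ∈ thickCone fun _ _ => False
  hasThickComplex : Nontrivial V → T.HasThickComplex

namespace SimpleGraph.IsTreeLike

variable {V V' : Type} [Fintype V] [Fintype V'] {T : SimpleGraph V} {T' : SimpleGraph V'}

theorem of_iso (h : T.IsTreeLike) (e : T ≃g T') : T'.IsTreeLike where
  nonempty := h.nonempty.map e
  neg_mem := by
    rw [← pushSet_graphVec_iso e, ← map_neg]
    exact pushSet_mem_thickCone (isSetHom_image e.injective) (fun _ _ h => h.elim) h.neg_mem
  hasThickComplex _ := (h.hasThickComplex e.toEquiv.nontrivial).of_iso e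

theorem of_subsingleton [Nonempty V] [Subsingleton V] (T : SimpleGraph V) : T.IsTreeLike where
  nonempty := inferInstance
  neg_mem := by
    rw [graphVec_of_unique, neg_zero]
    exact zero_mem _
  hasThickComplex h := (not_subsingleton V inferInstance).elim

theorem addLeaf (h : T.IsTreeLike) (u : V) : (addLeaf T u).IsTreeLike where
  nonempty := inferInstance
  neg_mem := by
    rw [graphVec_addLeaf, neg_add, neg_neg, ← map_neg]
    exact add_mem (pushSet_mem_thickCone (isSetHom_image (Option.some_injective V))
      (fun _ _ h => h.elim) h.neg_mem) (tVec_mem_thickCone _ _ _)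
  hasThickComplex _ := by
    -- A single vertex is not the frame of a complex; attaching a leaf to it gives `K₂`, the frame
    -- of the trivial complex.
    rcases subsingleton_or_nontrivial V with hV | hV
    · have hu := h.nonempty
      have htop : _root_.addLeaf T u = ⊤ := by
        ext (_ | a) (_ | b)
        · simp
        · simp [Subsingleton.elim b u]
        · simp [Subsingleton.elim a u]
        · simp [Subsingleton.elim a b]
      have hcard : Fintype.card (Option V) = 2 := by
        rw [Fintype.card_option, Fintype.card_eq_one_iff_nonempty_unique.2
          ⟨⟨⟨u⟩, fun a => Subsingleton.elim a u⟩⟩]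
      rw [htop]
      exact hasThickComplex_top_fin_two.of_iso
        (SimpleGraph.Iso.completeGraph (Fintype.equivFinOfCardEq hcard).symm)
    · exact (h.hasThickComplex hV).addLeaf u

theorem pathGraph (n : ℕ) : (SimpleGraph.pathGraph (n + 1)).IsTreeLike := by
  induction n with
  | zero =>
    have : Subsingleton (Fin (0 + 1)) := inferInstanceAs (Subsingleton (Fin 1))
    exact of_subsingleton _
  | succ n ih =>
    refine (ih.addLeaf (Fin.last n)).of_iso ⟨finSuccEquivLast.symm, ?_⟩
    rintro (_ | a) (_ | b)
    · simp
    · simp [SimpleGraph.pathGraph_adj, Fin.ext_iff]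
      omega
    · simp [SimpleGraph.pathGraph_adj, Fin.ext_iff]
      omega
    · simp [SimpleGraph.pathGraph_adj]

end SimpleGraph.IsTreeLike

theorem SimpleGraph.IsTree.isTreeLike {V : Type} [Fintype V] {T : SimpleGraph V}
    (hT : T.IsTree) : T.IsTreeLike := by
  classical
  induction hn : Fintype.card V generalizing V with
  | zero =>
    have := hT.1.nonempty
    exact absurd hn Fintype.card_ne_zero
  | succ n ih =>
    have := hT.1.nonempty
    rcases subsingleton_or_nontrivial V with hV | hV
    · exact .of_subsingleton _
    · obtain ⟨v, hv⟩ := hT.exists_vert_degree_one_of_nontrivial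
      obtain ⟨u, huv, hu⟩ := SimpleGraph.degree_eq_one_iff_existsUnique_adj.1 hv
      have hT' : (T.induce ({v}ᶜ : Set V)).IsTree :=
        ⟨hT.1.induce_compl_singleton_of_degree_eq_one hv, hT.2.induce _⟩
      have hc : Fintype.card ({v}ᶜ : Set V) = n := by
        rw [Fintype.card_compl_set, hn]
        simp
      have huc : u ∈ ({v}ᶜ : Set V) := huv.ne'
      refine ((ih hT' hc).addLeaf ⟨u, huc⟩).of_iso
        ⟨(Equiv.optionSubtypeNe v : Option ({v}ᶜ : Set V) ≃ V), ?_⟩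
      rintro (_ | ⟨a, ha⟩) (_ | ⟨b, hb⟩)
      · simp
      · change T.Adj v b ↔ _
        rw [addLeaf_none_some, Subtype.mk.injEq]
        exact ⟨hu b, fun h => h ▸ huv⟩
      · change T.Adj a v ↔ _
        rw [addLeaf_some_none, Subtype.mk.injEq, T.adj_comm]
        exact ⟨hu a, fun h => h ▸ huv⟩
      · change T.Adj a b ↔ _
        rw [addLeaf_some_some]
        rfl

/-- The four-cycle is the reflection of a path with two edges in its endpoints `x`, `y`. If `A`,
`A'` are the two copies of the path, its vector is the sum of their vectors, minus `t_{A,A'}`, which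
lies in `W_B`, plus `t_{{x},{y}}`, minus `1_∅`. The term `t_{{x},{y}}` trades the leftover
`-1_{{x,y}}` for `-1_{{x}} - 1_{{y}}`, and the `1_∅` it creates is removed along the line in `Q`. -/
theorem hasThickComplex_square :
    (SimpleGraph.boxProd (⊤ : SimpleGraph (Fin 2)) (⊤ : SimpleGraph (Fin 2))).HasThickComplex := by
  obtain ⟨M, hM, hf, hc⟩ := (SimpleGraph.IsTreeLike.pathGraph 2).hasThickComplex inferInstance
  set t₁ : Fin 3 → Fin 2 × Fin 2 := ![(0, 1), (0, 0), (1, 0)]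
  set t₂ : Fin 3 → Fin 2 × Fin 2 := ![(0, 1), (1, 1), (1, 0)]
  have hi₁ : Function.Injective t₁ := by decide
  have hi₂ : Function.Injective t₂ := by decide
  have hm : BHypergraph.IsMirror Set.univ {0, 2} t₁ t₂ :=
    { subset := Set.subset_univ _
      inj_left := hi₁
      inj_right := hi₂.injOn
      eq_iff := by
        intro v w _
        simp only [Set.mem_insert_iff, Set.mem_singleton_iff]
        revert v w
        decide
      cover := by
        simp only [Set.mem_univ, true_and]
        decide }
  have e₁₀ : t₁ 0 = (0, 1) := rfl
  have e₁₁ : t₁ 1 = (0, 0) := rfl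
  have e₁₂ : t₁ 2 = (1, 0) := rfl
  have e₂₀ : t₂ 0 = (0, 1) := rfl
  have e₂₁ : t₂ 1 = (1, 1) := rfl
  have e₂₂ : t₂ 2 = (1, 0) := rfl
  have hx : t₁ '' {0, 2} = {(0, 1), (1, 0)} := by
    rw [Set.image_pair, e₁₀, e₁₂]
  have hrel := BHypergraph.reflection_rel_univ hM.univ_mem hM.univ_mem hm
  refine ⟨_, hM.reflection hM.univ_mem hm, ?_, ?_⟩
  · ext a b
    rw [BHypergraph.frame_reflection_adj hM.nontrivial_of_mem hm]
    simp only [hf, SimpleGraph.pathGraph_adj, Set.mem_univ, true_and, SimpleGraph.boxProd_adj,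
      SimpleGraph.top_adj]
    revert a b
    decide
  · have h₁ := pushSet_mem_thickCone (b' := (M.reflection Set.univ {0, 2} t₁ t₂).rel)
      (isSetHom_image hi₁) (fun A B h => Or.inl ⟨A, B, h, rfl, rfl⟩) hc
    have h₂ := pushSet_mem_thickCone (b' := (M.reflection Set.univ {0, 2} t₁ t₂).rel)
      (isSetHom_image hi₂) (fun A B h => Or.inr (Or.inl
        ⟨A, B, h, Set.subset_univ _, Set.subset_univ _, rfl, rfl⟩)) hc
    have h₃ := neg_tVec_mem_thickCone hrel
    have h₄ := tVec_mem_thickCone (M.reflection Set.univ {0, 2} t₁ t₂).rel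
      ({(0, 1)} : Set (Fin 2 × Fin 2)) {(1, 0)}
    have h₅ := smul_oneAt_empty_mem_thickCone (M.reflection Set.univ {0, 2} t₁ t₂).rel (-1)
    convert add_mem (add_mem (add_mem (add_mem h₁ h₂) h₃) h₄) h₅ using 1
    rw [graphVec_boxProd, pushSet_graphVec, pushSet_graphVec, tVec, hm.image_union_image,
      hm.image_inter_image subset_rfl (Set.subset_univ _) (Set.subset_univ _), hx, tVec,
      Set.singleton_union, Set.singleton_inter_eq_empty.2 (by simp)]
    simp only [rungs, sliceEdges, sliceDeg, sliceVerts, degOne, Fin.sum_univ_two,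
      Fin.sum_univ_three, adjOne, SimpleGraph.pathGraph_adj, SimpleGraph.top_adj, Set.image_pair,
      Set.image_singleton, e₁₀, e₁₁, e₁₂, e₂₀, e₂₁, e₂₂]
    norm_num [Set.pair_comm]
    module

end

noncomputable section

/-! ### Entropy of finite random variables -/

section Entropy

variable {Z : Type*} [Fintype Z]

open Classical in
/-- The probability of the value of `f` at `a`. -/
def mass {Y : Type*} (p : Z → ℝ) (f : Z → Y) (a : Z) : ℝ := ∑ b with f b = f a, p b

/-- The negative of the entropy of `f`. -/
def negEntropy {Y : Type*} (p : Z → ℝ) (f : Z → Y) : ℝ := ∑ a, p a * Real.log (mass p f a)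

variable {p : Z → ℝ} {Y Y₁ Y₂ Y₃ : Type*}

theorem mass_congr {f : Z → Y} {g : Z → Y₁} (h : ∀ a b, f a = f b ↔ g a = g b) :
    mass p f = mass p g := by
  classical
  funext a
  exact Finset.sum_congr (Finset.filter_congr fun b _ => h b a) fun _ _ => rfl

theorem mass_eq_of_eq {f : Z → Y} {a b : Z} (h : f a = f b) : mass p f a = mass p f b := by
  classical
  exact Finset.sum_congr (Finset.filter_congr fun c _ => by rw [h]) fun _ _ => rfl

theorem mass_pos (hp : ∀ a, 0 < p a) (f : Z → Y) (a : Z) : 0 < mass p f a :=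
  Finset.sum_pos (fun b _ => hp b) ⟨a, by simp⟩

/-- Each non-empty fibre of `f` contributes `1` when its mass is nonzero, and every other fibre
contributes `0`. -/
theorem sum_div_mass_le [Fintype Y] (f : Z → Y) :
    ∑ a, p a / mass p f a ≤ Fintype.card Y := by
  classical
  rw [← Finset.sum_fiberwise Finset.univ f, ← Finset.card_univ, Finset.cast_card]
  refine Finset.sum_le_sum fun y _ => ?_
  have : ∀ a ∈ Finset.univ.filter (f · = y),
      p a / mass p f a = p a / ∑ b with f b = y, p b := by
    intro a ha
    simp only [mass, (Finset.mem_filter.1 ha).2]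
  rw [Finset.sum_congr rfl this, ← Finset.sum_div]
  exact div_self_le_one _

theorem neg_log_card_le_negEntropy (hp : ∀ a, 0 < p a) (h1 : ∑ a, p a = 1) [Fintype Y]
    (f : Z → Y) : -Real.log (Fintype.card Y) ≤ negEntropy p f := by
  have hZ : Nonempty Z := by
    by_contra h
    rw [not_nonempty_iff] at h
    simp at h1
  have hY : (0 : ℝ) < Fintype.card Y :=
    Nat.cast_pos.2 (Fintype.card_pos_iff.2 (hZ.map f))
  -- This is `1 - 1/x ≤ log x` at `x = mass · |Y|`, weighted by `p a`.
  have h2 : ∀ a, p a - p a / mass p f a / Fintype.card Y ≤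
      p a * Real.log (mass p f a) + p a * Real.log (Fintype.card Y) := by
    intro a
    have hm := mass_pos hp f a
    have := mul_le_mul_of_nonneg_left
      (Real.one_sub_inv_le_log_of_pos (mul_pos hm hY)) (hp a).le
    rw [Real.log_mul hm.ne' hY.ne'] at this
    calc _ = p a * (1 - (mass p f a * Fintype.card Y)⁻¹) := by field_simp
      _ ≤ _ := by rwa [← mul_add]
  have h3 := Finset.sum_le_sum fun a (_ : a ∈ Finset.univ) => h2 a
  rw [Finset.sum_sub_distrib, Finset.sum_add_distrib, ← Finset.sum_mul, ← Finset.sum_div, h1,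
    one_mul] at h3
  have h4 := (div_le_one hY).2 (sum_div_mass_le (p := p) f)
  unfold negEntropy
  linarith

/-- Submodularity of entropy. -/
theorem negEntropy_add_le (hp : ∀ a, 0 < p a) (h1 : ∑ a, p a = 1) {f : Z → Y} {g : Z → Y₁}
    {h : Z → Y₂} {k : Z → Y₃} (hh : ∀ a b, h a = h b ↔ f a = f b ∧ g a = g b)
    (hf : ∀ a b, f a = f b → k a = k b) (hg : ∀ a b, g a = g b → k a = k b) :
    negEntropy p f + negEntropy p g ≤ negEntropy p h + negEntropy p k := by
  classical
  -- The sum is the total mass that the conditionally independent coupling of `f` and `g` over `k`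
  -- gives to the values of `h`, hence at most `1`. Submodularity follows by the Gibbs inequality.
  have key : ∑ a, p a * (mass p f a * mass p g a / (mass p h a * mass p k a)) ≤ 1 := by
    have e1 : ∀ a, p a * (mass p f a * mass p g a / (mass p h a * mass p k a)) =
        ∑ b, ∑ c, (p b * p c / mass p k b) *
          if f a = f b ∧ g a = g c then p a / mass p h a else 0 := by
      intro a
      have hfa : mass p f a / mass p k a = ∑ b, if f a = f b then p b / mass p k b else 0 := by
        rw [mass, Finset.sum_div, Finset.sum_filter]
        refine Finset.sum_congr rfl fun b _ => ?_
        by_cases e : f b = f a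
        · rw [if_pos e, if_pos e.symm, mass_eq_of_eq (hf _ _ e)]
        · rw [if_neg e, if_neg (Ne.symm e)]
      have hga : mass p g a = ∑ c, if g a = g c then p c else 0 := by
        rw [mass, Finset.sum_filter]
        simp only [eq_comm]
      calc _ = (p a / mass p h a) * ((mass p f a / mass p k a) * mass p g a) := by
            have := (mass_pos hp h a).ne'
            have := (mass_pos hp k a).ne'
            field_simp
        _ = _ := by
            rw [hfa, hga, Finset.sum_mul_sum, Finset.mul_sum]
            refine Finset.sum_congr rfl fun b _ => ?_
            rw [Finset.mul_sum]
            refine Finset.sum_congr rfl fun c _ => ?_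
            by_cases e : f a = f b <;> by_cases e' : g a = g c <;> simp [e, e']
            ring
    -- The values of `f` and `g` determine that of `h`, so the points `a` counted form at most one
    -- fibre of `h`; there are none unless `b` and `c` have the same `k`-value.
    have e2 : ∀ b c, (∑ a, if f a = f b ∧ g a = g c then p a / mass p h a else 0) ≤
        if k c = k b then 1 else 0 := by
      intro b c
      rw [← Finset.sum_filter]
      by_cases e : k c = k b
      · rw [if_pos e]
        have : ∀ a ∈ Finset.univ.filter (fun a => f a = f b ∧ g a = g c),
            p a / mass p h a = p a / ∑ a with f a = f b ∧ g a = g c, p a := by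
          intro a ha
          obtain ⟨ha, ha'⟩ := (Finset.mem_filter.1 ha).2
          simp only [mass, hh, ha, ha']
        rw [Finset.sum_congr rfl this, ← Finset.sum_div]
        exact div_self_le_one _
      · rw [if_neg e, Finset.filter_false_of_mem, Finset.sum_empty]
        rintro a - ⟨ha, ha'⟩
        exact e ((hg _ _ ha').symm.trans (hf _ _ ha))
    calc _ = ∑ b, ∑ c, (p b * p c / mass p k b) *
          ∑ a, if f a = f b ∧ g a = g c then p a / mass p h a else 0 := by
          rw [Finset.sum_congr rfl fun a _ => e1 a, Finset.sum_comm]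
          refine Finset.sum_congr rfl fun b _ => ?_
          rw [Finset.sum_comm]
          simp only [Finset.mul_sum]
      _ ≤ ∑ b, ∑ c, (p b * p c / mass p k b) * if k c = k b then 1 else 0 := by
          refine Finset.sum_le_sum fun b _ => Finset.sum_le_sum fun c _ => ?_
          exact mul_le_mul_of_nonneg_left (e2 b c)
            (div_nonneg (mul_nonneg (hp b).le (hp c).le) (mass_pos hp k b).le)
      _ = ∑ b, p b := by
          refine Finset.sum_congr rfl fun b _ => ?_
          have : ∑ c, (p b * p c / mass p k b) * (if k c = k b then 1 else 0) =
              p b / mass p k b * mass p k b := by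
            simp only [mul_ite, mul_one, mul_zero]
            rw [← Finset.sum_filter]
            calc _ = p b / mass p k b * ∑ c with k c = k b, p c := by
                  rw [Finset.mul_sum]
                  exact Finset.sum_congr rfl fun c _ => mul_div_right_comm _ _ _
              _ = _ := rfl
          rw [this, div_mul_cancel₀ _ (mass_pos hp k b).ne']
      _ = 1 := h1
  have h2 : ∀ a, p a - p a * (mass p f a * mass p g a / (mass p h a * mass p k a)) ≤
      p a * Real.log (mass p h a) + p a * Real.log (mass p k a) -
        (p a * Real.log (mass p f a) + p a * Real.log (mass p g a)) := by
    intro a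
    have h₁ := mass_pos hp f a
    have h₂ := mass_pos hp g a
    have h₃ := mass_pos hp h a
    have h₄ := mass_pos hp k a
    have := mul_le_mul_of_nonneg_left (Real.one_sub_inv_le_log_of_pos
      (div_pos (mul_pos h₃ h₄) (mul_pos h₁ h₂))) (hp a).le
    rw [Real.log_div (mul_pos h₃ h₄).ne' (mul_pos h₁ h₂).ne', Real.log_mul h₃.ne' h₄.ne',
      Real.log_mul h₁.ne' h₂.ne', inv_div] at this
    linarith
  have h3 := Finset.sum_le_sum fun a (_ : a ∈ Finset.univ) => h2 a
  simp only [Finset.sum_sub_distrib, Finset.sum_add_distrib, h1] at h3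
  unfold negEntropy
  linarith

end Entropy

/-! ### Random homomorphisms from frames of reflection complexes -/

section Model

/-- The probability, under `p`, of the values of `ξ a` on `S`. -/
def marginal {Z V Ω : Type*} [Fintype Z] (p : Z → ℝ) (ξ : Z → V → Ω) (S : Set V) (a : Z) : ℝ :=
  mass p (fun b => S.domRestrict (ξ b)) a

open Classical in
theorem marginal_eq {Z V Ω : Type*} [Fintype Z] (p : Z → ℝ) (ξ : Z → V → Ω) (S : Set V) (a : Z) :
    marginal p ξ S a = ∑ b, if Set.EqOn (ξ b) (ξ a) S then p b else 0 := by
  rw [marginal, mass, ← Finset.sum_filter]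
  exact Finset.sum_congr (Finset.filter_congr fun b _ => Set.domRestrict_eq_domRestrict_iff)
    fun _ _ => rfl

/-- A random map `ξ : V → Ω` for which the pairs in the relation of `M` are conditionally
independent and the edges of the frame of `M` are mapped to uniformly distributed edges of `G`. -/
structure IsMarkovModel {V Ω Z : Type*} [Fintype Z] (M : BHypergraph V) (G : SimpleGraph Ω)
    (p : Z → ℝ) (ξ : Z → V → Ω) : Prop where
  pos : ∀ a, 0 < p a
  sum_eq_one : ∑ a, p a = 1
  indep : ∀ A B, M.rel A B → ∀ a,
    marginal p ξ (A ∪ B) a * marginal p ξ (A ∩ B) a = marginal p ξ A a * marginal p ξ B a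
  adj : ∀ u v, M.frame.Adj u v → ∀ a, G.Adj (ξ a u) (ξ a v)
  uniform : ∀ u v, M.frame.Adj u v → ∀ a,
    marginal p ξ {u, v} a = (Nat.card ((⊤ : SimpleGraph (Fin 2)) →g G) : ℝ)⁻¹

theorem isMarkovModel_trivialComplex {Ω : Type*} (G : SimpleGraph Ω)
    [Fintype ((⊤ : SimpleGraph (Fin 2)) →g G)] [Nonempty ((⊤ : SimpleGraph (Fin 2)) →g G)] :
    IsMarkovModel BHypergraph.trivialComplex G
      (fun _ => (Nat.card ((⊤ : SimpleGraph (Fin 2)) →g G) : ℝ)⁻¹)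
      fun a : (⊤ : SimpleGraph (Fin 2)) →g G => a where
  pos _ := inv_pos.2 (Nat.cast_pos.2 Nat.card_pos)
  sum_eq_one := by
    rw [Finset.sum_const, Finset.card_univ, Nat.card_eq_fintype_card, nsmul_eq_mul,
      mul_inv_cancel₀]
    exact Nat.cast_ne_zero.2 Fintype.card_ne_zero
  indep _ _ h := h.elim
  adj u v h a := a.map_adj (by rwa [BHypergraph.frame_trivialComplex] at h)
  uniform u v h a := by
    classical
    have huv : ({u, v} : Set (Fin 2)) = Set.univ := h.2
    rw [marginal_eq, huv]
    simp only [Set.eqOn_univ, DFunLike.coe_fn_eq]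
    simp

variable {V V' Ω Z : Type*} [Fintype Z] {M : BHypergraph V} {G : SimpleGraph Ω}
  {p : Z → ℝ} {ξ : Z → V → Ω} {L X : Set V} {t₁ t₂ : V → V'}

/-- Pairs of maps that agree on `X`. -/
abbrev AgreeOn (ξ : Z → V → Ω) (X : Set V) : Type _ := {z : Z × Z // Set.EqOn (ξ z.1) (ξ z.2) X}

/-- The two copies overlap only in `X`, where `x` and `y` agree. -/
theorem BHypergraph.IsMirror.exists_glue (ht : BHypergraph.IsMirror L X t₁ t₂) {x y : V → Ω}
    (hxy : Set.EqOn x y X) : ∃ z : V' → Ω, (∀ v, z (t₁ v) = x v) ∧ ∀ w ∈ L, z (t₂ w) = y w := by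
  classical
  have h : ∀ z : V', ∃ o : Ω, (∀ v, t₁ v = z → o = x v) ∧ ∀ w ∈ L, t₂ w = z → o = y w := by
    intro z
    rcases ht.cover z with ⟨v, rfl⟩ | ⟨w, hw, rfl⟩
    · refine ⟨x v, fun v' hv => by rw [ht.inj_left hv], fun w hw e => ?_⟩
      obtain ⟨rfl, hv⟩ := (ht.eq_iff v w hw).1 e.symm
      exact hxy hv
    · refine ⟨y w, fun v e => ?_, fun w' hw' e => by rw [ht.inj_right hw' hw e]⟩
      obtain ⟨rfl, hv⟩ := (ht.eq_iff v w hw).1 e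
      exact (hxy hv).symm
  choose z hz using h
  exact ⟨z, fun v => (hz _).1 v rfl, fun w hw => (hz _).2 w hw rfl⟩

/-- The weights of the conditionally independent coupling over the values on `X`. -/
def coupling (p : Z → ℝ) (ξ : Z → V → Ω) (X : Set V) (z : AgreeOn ξ X) : ℝ :=
  p z.1.1 * p z.1.2 / marginal p ξ X z.1.1

theorem marginal_pos (hp : ∀ a, 0 < p a) (S : Set V) (a : Z) : 0 < marginal p ξ S a :=
  mass_pos hp _ a

theorem marginal_eq_of_eqOn {S : Set V} {a b : Z} (h : Set.EqOn (ξ a) (ξ b) S) :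
    marginal p ξ S a = marginal p ξ S b :=
  mass_eq_of_eq (Set.domRestrict_eq_domRestrict_iff.2 h)

open Classical in
theorem sum_coupling [Fintype (AgreeOn ξ X)] (c₁ c₂ : Z → Prop) :
    ∑ z, (if c₁ z.1.1 ∧ c₂ z.1.2 then coupling p ξ X z else 0) =
      ∑ a, ∑ b, if Set.EqOn (ξ a) (ξ b) X ∧ c₁ a ∧ c₂ b then
        p a * p b / marginal p ξ X a else 0 := by
  rw [← Fintype.sum_prod_type' (f := fun a b => if Set.EqOn (ξ a) (ξ b) X ∧ c₁ a ∧ c₂ b then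
        p a * p b / marginal p ξ X a else 0)]
  simp only [ite_and (Set.EqOn _ _ _)]
  conv_rhs => rw [← Finset.sum_filter,
    Finset.sum_subtype (p := fun z : Z × Z => Set.EqOn (ξ z.1) (ξ z.2) X) _ fun z => by simp]
  rfl

-- The first coordinate of the coupling has law `p`: summing over the second coordinate produces the
-- marginal on `X`, which cancels the denominator.
open Classical in
theorem sum_coupling_left (hp : ∀ a, 0 < p a) [Fintype (AgreeOn ξ X)] (c : Z → Prop) :
    ∑ z, (if c z.1.1 then coupling p ξ X z else 0) = ∑ a, if c a then p a else 0 := by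
  have h := sum_coupling (p := p) (ξ := ξ) (X := X) c fun _ => True
  simp only [and_true] at h
  rw [h]
  refine Finset.sum_congr rfl fun a _ => ?_
  by_cases hc : c a
  · simp only [hc, and_true, if_true]
    have : ∑ b, (if Set.EqOn (ξ a) (ξ b) X then p a * p b / marginal p ξ X a else 0) =
        p a / marginal p ξ X a * marginal p ξ X a := by
      have hX := marginal_eq p ξ X a
      generalize marginal p ξ X a = m at hX ⊢
      calc _ = p a / m * ∑ b, (if Set.EqOn (ξ b) (ξ a) X then p b else 0) := by
            rw [Finset.mul_sum]
            refine Finset.sum_congr rfl fun b _ => ?_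
            rw [Set.eqOn_comm]
            split_ifs <;> ring
        _ = _ := by rw [← hX]
    rw [this, div_mul_cancel₀ _ (marginal_pos hp X a).ne']
  · simp [hc]

open Classical in
theorem sum_coupling_right (hp : ∀ a, 0 < p a) [Fintype (AgreeOn ξ X)] (c : Z → Prop) :
    ∑ z, (if c z.1.2 then coupling p ξ X z else 0) = ∑ b, if c b then p b else 0 := by
  rw [← sum_coupling_left (ξ := ξ) (X := X) hp c]
  -- Exchanging the coordinates preserves the coupling, since both have the same marginal on `X`.
  let e : AgreeOn ξ X ≃ AgreeOn ξ X :=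
    { toFun z := ⟨(z.1.2, z.1.1), z.2.symm⟩
      invFun z := ⟨(z.1.2, z.1.1), z.2.symm⟩
      left_inv _ := rfl
      right_inv _ := rfl }
  rw [← e.sum_comp]
  refine Finset.sum_congr rfl fun z _ => ?_
  have : coupling p ξ X (e z) = coupling p ξ X z := by
    change p z.1.2 * p z.1.1 / marginal p ξ X z.1.2 = _
    rw [← marginal_eq_of_eqOn z.2, mul_comm (p z.1.2)]
    rfl
  rw [this]
  rfl

/-- Each copy retains its old marginals, so old relations and the conditions on frame edges persist.
The new relations hold because the copies are conditionally independent given the values on `X`. -/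
theorem IsMarkovModel.reflection (h : IsMarkovModel M G p ξ) (hM : ∀ K ∈ M.edges, K.Nontrivial)
    (ht : BHypergraph.IsMirror L X t₁ t₂) [Fintype (AgreeOn ξ X)] {ζ : AgreeOn ξ X → V' → Ω}
    (hζ₁ : ∀ z v, ζ z (t₁ v) = ξ z.1.1 v) (hζ₂ : ∀ z, ∀ w ∈ L, ζ z (t₂ w) = ξ z.1.2 w) :
    IsMarkovModel (M.reflection L X t₁ t₂) G (coupling p ξ X) ζ := by
  classical
  have hE₁ : ∀ (K : Set V) z z', Set.EqOn (ζ z') (ζ z) (t₁ '' K) ↔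
      Set.EqOn (ξ z'.1.1) (ξ z.1.1) K := by
    intro K z z'
    simp only [Set.EqOn, Set.forall_mem_image, hζ₁]
  have hE₂ : ∀ (K : Set V), K ⊆ L → ∀ z z', Set.EqOn (ζ z') (ζ z) (t₂ '' K) ↔
      Set.EqOn (ξ z'.1.2) (ξ z.1.2) K := by
    intro K hK z z'
    simp only [Set.EqOn, Set.forall_mem_image]
    exact forall₂_congr fun w hw => by rw [hζ₂ _ _ (hK hw), hζ₂ _ _ (hK hw)]
  have hm₁ : ∀ (K : Set V) z, marginal (coupling p ξ X) ζ (t₁ '' K) z =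
      marginal p ξ K z.1.1 := by
    intro K z
    rw [marginal_eq, marginal_eq]
    simp only [hE₁]
    exact sum_coupling_left h.pos fun a => Set.EqOn (ξ a) (ξ z.1.1) K
  have hm₂ : ∀ (K : Set V), K ⊆ L → ∀ z, marginal (coupling p ξ X) ζ (t₂ '' K) z =
      marginal p ξ K z.1.2 := by
    intro K hK z
    rw [marginal_eq, marginal_eq]
    simp only [hE₂ K hK]
    exact sum_coupling_right h.pos fun a => Set.EqOn (ξ a) (ξ z.1.2) K
  -- Agreement on `K₁` and on `K₂` forces agreement on `X`, so the constraint defining the coupling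
  -- is automatic and the sum factors.
  have hm₃ : ∀ (K₁ K₂ : Set V), K₂ ⊆ L → X ⊆ K₁ → X ⊆ K₂ → ∀ z,
      marginal (coupling p ξ X) ζ (t₁ '' K₁ ∪ t₂ '' K₂) z =
        marginal p ξ K₁ z.1.1 * marginal p ξ K₂ z.1.2 / marginal p ξ X z.1.1 := by
    intro K₁ K₂ hL hX₁ hX₂ z
    rw [marginal_eq]
    simp only [Set.eqOn_union, hE₁, hE₂ K₂ hL]
    rw [sum_coupling (fun a => Set.EqOn (ξ a) (ξ z.1.1) K₁) fun b => Set.EqOn (ξ b) (ξ z.1.2) K₂,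
      marginal_eq, marginal_eq p ξ K₂, Finset.sum_mul_sum, Finset.sum_div]
    refine Finset.sum_congr rfl fun a _ => ?_
    rw [Finset.sum_div]
    refine Finset.sum_congr rfl fun b _ => ?_
    by_cases ha : Set.EqOn (ξ a) (ξ z.1.1) K₁
    · by_cases hb : Set.EqOn (ξ b) (ξ z.1.2) K₂
      · have hab : Set.EqOn (ξ a) (ξ b) X :=
          ((ha.mono hX₁).trans z.2).trans (hb.mono hX₂).symm
        rw [if_pos ⟨hab, ha, hb⟩, if_pos ha, if_pos hb, marginal_eq_of_eqOn (ha.mono hX₁)]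
      · simp [hb]
    · simp [ha]
  refine ⟨fun z => ?_, ?_, ?_, ?_, ?_⟩
  · exact div_pos (mul_pos (h.pos _) (h.pos _)) (marginal_pos h.pos _ _)
  · simpa [h.sum_eq_one] using
      sum_coupling_left (p := p) (ξ := ξ) (X := X) h.pos fun _ => True
  · rintro A B (⟨A₁, B₁, hr, rfl, rfl⟩ | ⟨A₂, B₂, hr, hA, hB, rfl, rfl⟩ |
      ⟨K₁, -, K₂, -, hL, hX₁, hX₂, hK⟩) z
    · rw [← Set.image_union, ← Set.image_inter ht.inj_left]
      simp only [hm₁]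
      exact h.indep _ _ hr _
    · rw [← Set.image_union, ← ht.inj_right.image_inter hA hB, hm₂ _ hA, hm₂ _ hB,
        hm₂ _ (Set.union_subset hA hB), hm₂ _ (Set.inter_subset_left.trans hA)]
      exact h.indep _ _ hr _
    · have key : marginal (coupling p ξ X) ζ (t₁ '' K₁ ∪ t₂ '' K₂) z *
          marginal (coupling p ξ X) ζ (t₁ '' K₁ ∩ t₂ '' K₂) z =
          marginal (coupling p ξ X) ζ (t₁ '' K₁) z *
            marginal (coupling p ξ X) ζ (t₂ '' K₂) z := by
        rw [ht.image_inter_image hL hX₁ hX₂, hm₃ _ _ hL hX₁ hX₂, hm₁, hm₁, hm₂ _ hL,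
          div_mul_cancel₀ _ (marginal_pos h.pos _ _).ne']
      rcases hK with ⟨rfl, rfl⟩ | ⟨rfl, rfl⟩
      · exact key
      · rw [Set.union_comm, Set.inter_comm, key, mul_comm]
  · intro a b hab z
    rcases (BHypergraph.frame_reflection_adj hM ht a b).1 hab with
      ⟨u, v, huv, rfl, rfl⟩ | ⟨u, hu, v, hv, huv, rfl, rfl⟩
    · rw [hζ₁, hζ₁]
      exact h.adj _ _ huv _
    · rw [hζ₂ _ _ hu, hζ₂ _ _ hv]
      exact h.adj _ _ huv _
  · intro a b hab z
    rcases (BHypergraph.frame_reflection_adj hM ht a b).1 hab with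
      ⟨u, v, huv, rfl, rfl⟩ | ⟨u, hu, v, hv, huv, rfl, rfl⟩
    · rw [← Set.image_pair, hm₁]
      exact h.uniform _ _ huv _
    · rw [← Set.image_pair, hm₂ _ (by rintro w (rfl | rfl) <;> assumption)]
      exact h.uniform _ _ huv _

end Model

theorem BHypergraph.IsReflectionComplex.exists_isMarkovModel {V Ω : Type} {M : BHypergraph V}
    (hM : M.IsReflectionComplex) [Finite Ω] (G : SimpleGraph Ω)
    [Nonempty ((⊤ : SimpleGraph (Fin 2)) →g G)] :
    ∃ (Z : Type) (_ : Fintype Z) (p : Z → ℝ) (ξ : Z → V → Ω), IsMarkovModel M G p ξ := by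
  classical
  refine hM.reflection_induction (motive := fun {V} M => ∃ (Z : Type) (_ : Fintype Z) (p : Z → ℝ)
    (ξ : Z → V → Ω), IsMarkovModel M G p ξ) ?_ ?_
  · have : Finite ((⊤ : SimpleGraph (Fin 2)) →g G) := DFunLike.finite _
    have := Fintype.ofFinite ((⊤ : SimpleGraph (Fin 2)) →g G)
    exact ⟨_, this, _, _, isMarkovModel_trivialComplex G⟩
  · rintro V V' M L X t₁ t₂ hM ⟨Z, _, p, ξ, h⟩ hL ht
    choose ζ hζ using fun z : AgreeOn ξ X => ht.exists_glue z.2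
    have := Fintype.ofFinite (AgreeOn ξ X)
    exact ⟨AgreeOn ξ X, this, _, ζ, h.reflection hM.nontrivial_of_mem ht (fun z => (hζ z).1)
      fun z => (hζ z).2⟩

end

noncomputable section

/-! ### From thickness to Sidorenko's inequality -/

section Evaluation

variable {V : Type*} [Finite V]

/-- The linear functional with value `D S` at `1_S`. -/
def evalSet (D : Set V → ℝ) : (Set V → ℝ) →ₗ[ℝ] ℝ := (Pi.basisFun ℝ (Set V)).constr ℝ D

@[simp]
theorem evalSet_oneAt (D : Set V → ℝ) (S : Set V) : evalSet D (oneAt S) = D S := by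
  classical
  have : oneAt S = Pi.basisFun ℝ (Set V) S := by
    ext T
    simp [oneAt, Set.indicator_apply, Pi.single_apply]
  rw [this, evalSet, Module.Basis.constr_basis]

theorem evalSet_tVec (D : Set V → ℝ) (A B : Set V) :
    evalSet D (tVec A B) = D (A ∪ B) - D A - D B + D (A ∩ B) := by
  simp [tVec]

/-- The functional is non-negative on the generators of the cone and zero on `W_b` and on `1_∅`,
which is why these may enter with either sign. -/
theorem evalSet_nonneg {D : Set V → ℝ} {b : Set V → Set V → Prop} (h₀ : D ∅ = 0)
    (hn : ∀ A, 0 ≤ D A) (hs : ∀ A B, D A + D B ≤ D (A ∪ B) + D (A ∩ B))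
    (hb : ∀ A B, b A B → D A + D B = D (A ∪ B) + D (A ∩ B)) {x : Set V → ℝ}
    (hx : x ∈ thickCone b) : 0 ≤ evalSet D x := by
  let C : Submodule NNReal (Set V → ℝ) :=
    { carrier := {x | 0 ≤ evalSet D x}
      add_mem' := fun {x y} hx hy => by
        change 0 ≤ evalSet D (x + y)
        rw [map_add]
        exact add_nonneg hx hy
      zero_mem' := by
        change 0 ≤ evalSet D 0
        rw [map_zero]
      smul_mem' := fun r x hx => by
        change 0 ≤ evalSet D ((r : ℝ) • x)
        rw [map_smul]
        exact mul_nonneg r.2 hx }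
  suffices h : thickCone b ≤ C from h hx
  refine sup_le ?_ (sup_le ?_ ?_)
  · intro y hy
    have : relSpan b ≤ LinearMap.ker (evalSet D) := by
      refine Submodule.span_le.2 ?_
      rintro _ ⟨A, B, hAB, rfl⟩
      change evalSet D (tVec A B) = 0
      rw [evalSet_tVec]
      linarith [hb A B hAB]
    exact (LinearMap.mem_ker.1 (this hy)).ge
  · intro y hy
    obtain ⟨r, rfl⟩ := Submodule.mem_span_singleton.1 hy
    change 0 ≤ evalSet D (r • oneAt ∅)
    rw [map_smul, evalSet_oneAt, h₀, smul_zero]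
  · rw [Submodule.span_le]
    rintro _ (⟨A, B, rfl⟩ | ⟨A, rfl⟩)
    · change 0 ≤ evalSet D (tVec A B)
      rw [evalSet_tVec]
      linarith [hs A B]
    · change 0 ≤ evalSet D (oneAt A)
      rw [evalSet_oneAt]
      exact hn A

theorem evalSet_graphVec {V : Type*} [Fintype V] (D : Set V → ℝ) (H : SimpleGraph V) :
    evalSet D (graphVec H) = -D Set.univ + (1 / 2 : ℝ) • ∑ u, ∑ v, adjOne H u v • D {u, v} -
      ∑ v, (degOne H v - 1) * D {v} := by
  simp only [graphVec, map_sub, map_add, map_neg, map_smul, map_sum, evalSet_oneAt, smul_eq_mul]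

end Evaluation

/-- The relative entropy, with respect to the uniform distribution, of the values of `ξ` on `S`. -/
def relEntropy {V Ω Z : Type*} [Fintype Z] (p : Z → ℝ) (ξ : Z → V → Ω) (S : Set V) : ℝ :=
  S.ncard * Real.log (Nat.card Ω) + negEntropy p fun a => S.domRestrict (ξ a)

section RelEntropy

variable {V Ω Z : Type*} [Fintype Z] {p : Z → ℝ} {ξ : Z → V → Ω}

theorem relEntropy_empty (h1 : ∑ a, p a = 1) : relEntropy p ξ ∅ = 0 := by
  have : ∀ a, mass p (fun a => (∅ : Set V).domRestrict (ξ a)) a = 1 := by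
    intro a
    change marginal p ξ ∅ a = 1
    rw [marginal_eq]
    simp [h1]
  simp [relEntropy, negEntropy, this]

theorem relEntropy_nonneg [Finite V] [Finite Ω] (hp : ∀ a, 0 < p a) (h1 : ∑ a, p a = 1)
    (S : Set V) : 0 ≤ relEntropy p ξ S := by
  classical
  have := Fintype.ofFinite Ω
  have := Fintype.ofFinite S
  have h := neg_log_card_le_negEntropy hp h1 fun a => S.domRestrict (ξ a)
  rw [Fintype.card_fun, Nat.cast_pow, Real.log_pow, ← Nat.card_eq_fintype_card,
    ← Nat.card_eq_fintype_card, Nat.card_coe_set_eq] at h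
  unfold relEntropy
  linarith

/-- Cardinality is modular, so this is submodularity of entropy. -/
theorem relEntropy_add_le [Finite V] (hp : ∀ a, 0 < p a) (h1 : ∑ a, p a = 1) (A B : Set V) :
    relEntropy p ξ A + relEntropy p ξ B ≤ relEntropy p ξ (A ∪ B) + relEntropy p ξ (A ∩ B) := by
  have hc : ((A ∪ B).ncard : ℝ) + (A ∩ B).ncard = A.ncard + B.ncard :=
    mod_cast Set.ncard_union_add_ncard_inter A B
  have h := negEntropy_add_le (f := fun a => A.domRestrict (ξ a))
    (g := fun a => B.domRestrict (ξ a)) (h := fun a => (A ∪ B).domRestrict (ξ a))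
    (k := fun a => (A ∩ B).domRestrict (ξ a)) hp h1
    (by simp only [Set.domRestrict_eq_domRestrict_iff, Set.eqOn_union, implies_true])
    (by
      simp only [Set.domRestrict_eq_domRestrict_iff]
      exact fun a b h => h.mono Set.inter_subset_left)
    (by
      simp only [Set.domRestrict_eq_domRestrict_iff]
      exact fun a b h => h.mono Set.inter_subset_right)
  have hl := congrArg (· * Real.log (Nat.card Ω)) hc
  simp only [add_mul] at hl
  unfold relEntropy
  linarith

theorem relEntropy_add_eq [Finite V] (hp : ∀ a, 0 < p a) {A B : Set V}
    (h : ∀ a, marginal p ξ (A ∪ B) a * marginal p ξ (A ∩ B) a =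
      marginal p ξ A a * marginal p ξ B a) :
    relEntropy p ξ A + relEntropy p ξ B = relEntropy p ξ (A ∪ B) + relEntropy p ξ (A ∩ B) := by
  have hc : ((A ∪ B).ncard : ℝ) + (A ∩ B).ncard = A.ncard + B.ncard :=
    mod_cast Set.ncard_union_add_ncard_inter A B
  have hl := congrArg (· * Real.log (Nat.card Ω)) hc
  simp only [add_mul] at hl
  have he : ∑ a, p a * Real.log (marginal p ξ A a) + ∑ a, p a * Real.log (marginal p ξ B a) =
      ∑ a, p a * Real.log (marginal p ξ (A ∪ B) a) +
        ∑ a, p a * Real.log (marginal p ξ (A ∩ B) a) := by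
    simp only [← Finset.sum_add_distrib, ← mul_add]
    refine Finset.sum_congr rfl fun a _ => ?_
    rw [← Real.log_mul (marginal_pos hp _ _).ne' (marginal_pos hp _ _).ne',
      ← Real.log_mul (marginal_pos hp _ _).ne' (marginal_pos hp _ _).ne', h]
  unfold relEntropy
  change _ + ∑ a, p a * Real.log (marginal p ξ A a) +
    (_ + ∑ a, p a * Real.log (marginal p ξ B a)) =
    _ + ∑ a, p a * Real.log (marginal p ξ (A ∪ B) a) +
      (_ + ∑ a, p a * Real.log (marginal p ξ (A ∩ B) a))
  linarith

end RelEntropy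

theorem finite_hom {V W : Type*} [Finite V] [Finite W] (H : SimpleGraph V) (G : SimpleGraph W) :
    Finite (H →g G) :=
  DFunLike.finite _

theorem homDensity_congr {V V' W : Type*} {H : SimpleGraph V} {H' : SimpleGraph V'} (e : H ≃g H')
    (G : SimpleGraph W) : homDensity H G = homDensity H' G := by
  rw [homDensity, homDensity, Nat.card_congr e.toEquiv]
  congr 2
  exact Nat.card_congr
    { toFun f := f.comp e.symm.toHom
      invFun f := f.comp e.toHom
      left_inv f := by ext v; simp
      right_inv f := by ext v; simp }

theorem SimpleGraph.SatisfiesSidorenko.of_iso {V V' : Type*} {H : SimpleGraph V}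
    {H' : SimpleGraph V'} (h : H'.SatisfiesSidorenko) (e : H ≃g H') : H.SatisfiesSidorenko := by
  intro W _ _ G
  rw [homDensity_congr e, Nat.card_congr e.mapEdgeSet]
  exact h W G

theorem SimpleGraph.satisfiesSidorenko_of_subsingleton {V : Type*} [Nonempty V] [Subsingleton V]
    (H : SimpleGraph V) : H.SatisfiesSidorenko := by
  intro W _ _ G
  obtain rfl : H = ⊥ := Subsingleton.elim _ _
  have h : Nat.card ((⊥ : SimpleGraph V) →g G) = Nat.card (V → W) :=
    Nat.card_congr
      { toFun f := f
        invFun f := ⟨f, fun h => h.elim⟩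
        left_inv _ := rfl
        right_inv _ := rfl }
  have hW : (Nat.card W : ℝ) ≠ 0 := Nat.cast_ne_zero.2 Nat.card_pos.ne'
  rw [homDensity.eq_1 (⊥ : SimpleGraph V), h, Nat.card_fun, Nat.cast_pow, div_self (pow_ne_zero _ hW)]
  simp

theorem sum_adjOne_eq_card_edgeSet {V : Type*} [Fintype V] (H : SimpleGraph V) (c : ℝ) :
    (1 / 2 : ℝ) • ∑ u, ∑ v, adjOne H u v • c = Nat.card H.edgeSet * c := by
  classical
  rw [← sum_edgeFinset_eq_half_sum H fun _ => c, Finset.sum_const, nsmul_eq_mul,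
    Nat.card_eq_fintype_card, SimpleGraph.edgeFinset_card]

/-- Thick graphs satisfy Sidorenko's conjecture. -/
theorem SimpleGraph.HasThickComplex.satisfiesSidorenko {V : Type} [Fintype V] {H : SimpleGraph V}
    (h : H.HasThickComplex) : H.SatisfiesSidorenko := by
  classical
  intro W _ _ G
  obtain ⟨M, hM, rfl, hc⟩ := h
  have hfin := finite_hom (⊤ : SimpleGraph (Fin 2)) G
  have hfin' := finite_hom M.frame G
  have hedge : Nat.card M.frame.edgeSet ≠ 0 := by
    obtain ⟨v, -⟩ := (hM.nontrivial_of_mem _ hM.univ_mem).nonempty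
    obtain ⟨u, hu⟩ := hM.exists_adj v
    have : Nonempty M.frame.edgeSet := ⟨⟨s(v, u), hu⟩⟩
    exact Nat.card_pos.ne'
  -- If `G` has no edge, the left-hand side is `0` to a positive power.
  rcases isEmpty_or_nonempty ((⊤ : SimpleGraph (Fin 2)) →g G) with hN | hN
  · have : homDensity (⊤ : SimpleGraph (Fin 2)) G = 0 := by simp [homDensity]
    rw [this, zero_pow hedge]
    exact div_nonneg (Nat.cast_nonneg _) (pow_nonneg (Nat.cast_nonneg _) _)
  obtain ⟨Z, _, p, ξ, hm⟩ := hM.exists_isMarkovModel G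
  have hn : (0 : ℝ) < Nat.card W := Nat.cast_pos.2 Nat.card_pos
  have hNpos : (0 : ℝ) < Nat.card ((⊤ : SimpleGraph (Fin 2)) →g G) := Nat.cast_pos.2 Nat.card_pos
  have hZ : Nonempty Z := by
    by_contra hZ
    rw [not_nonempty_iff] at hZ
    simpa using hm.sum_eq_one
  let φ : Z → (M.frame →g G) := fun a => ⟨ξ a, fun {u v} huv => hm.adj u v huv a⟩
  have hhom : Nonempty (M.frame →g G) := hZ.map φ
  have hhpos : (0 : ℝ) < Nat.card (M.frame →g G) := Nat.cast_pos.2 Nat.card_pos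
  have hnonneg := evalSet_nonneg (relEntropy_empty hm.sum_eq_one)
    (relEntropy_nonneg hm.pos hm.sum_eq_one) (relEntropy_add_le hm.pos hm.sum_eq_one)
    (fun A B hAB => relEntropy_add_eq hm.pos (hm.indep A B hAB)) hc
  -- The pair is uniform on the homomorphisms from `K₂` to `G`, so its relative entropy is `-log
  -- t(e, G)`.
  have hedges : ∀ u v, adjOne M.frame u v • relEntropy p ξ {u, v} =
      adjOne M.frame u v • -Real.log (homDensity (⊤ : SimpleGraph (Fin 2)) G) := by
    intro u v
    by_cases huv : M.frame.Adj u v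
    · congr 1
      rw [relEntropy, Set.ncard_pair huv.ne]
      change _ + ∑ a, p a * Real.log (marginal p ξ {u, v} a) = _
      simp only [hm.uniform u v huv]
      rw [← Finset.sum_mul, hm.sum_eq_one, homDensity,
        Real.log_div hNpos.ne' (pow_ne_zero _ hn.ne'), Real.log_pow, Real.log_inv]
      simp only [Nat.card_eq_fintype_card, Fintype.card_fin]
      ring
    · rw [adjOne_of_not_adj huv, zero_smul, zero_smul]
  have hdeg : 0 ≤ ∑ v, (degOne M.frame v - 1) * relEntropy p ξ {v} := by
    refine Finset.sum_nonneg fun u _ => mul_nonneg ?_ (relEntropy_nonneg hm.pos hm.sum_eq_one _)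
    exact sub_nonneg.2 (one_le_degOne (hM.exists_adj u))
  -- The random map takes values in the homomorphisms, so its entropy is at most the logarithm of
  -- their number.
  have huniv : Nat.card V * Real.log (Nat.card W) - Real.log (Nat.card (M.frame →g G)) ≤
      relEntropy p ξ Set.univ := by
    have := Fintype.ofFinite (M.frame →g G)
    have h := neg_log_card_le_negEntropy hm.pos hm.sum_eq_one φ
    have hφ : mass p φ = mass p fun a => Set.univ.domRestrict (ξ a) := by
      refine mass_congr fun a b => ?_
      rw [Set.domRestrict_eq_domRestrict_iff, Set.eqOn_univ, ← DFunLike.coe_fn_eq]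
      rfl
    rw [negEntropy, hφ, ← Nat.card_eq_fintype_card] at h
    rw [relEntropy, Set.ncard_univ]
    unfold negEntropy
    linarith
  rw [evalSet_graphVec] at hnonneg
  simp only [hedges, sum_adjOne_eq_card_edgeSet] at hnonneg
  have ht : 0 < homDensity (⊤ : SimpleGraph (Fin 2)) G := div_pos hNpos (pow_pos hn _)
  have ht' : 0 < homDensity M.frame G := div_pos hhpos (pow_pos hn _)
  rw [← Real.log_le_log_iff (pow_pos ht _) ht', Real.log_pow, homDensity.eq_1 M.frame,
    Real.log_div hhpos.ne' (pow_ne_zero _ hn.ne'), Real.log_pow]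
  linarith

/-! ### Tree factors, grids and hypercubes -/

/-- Cartesian products of isomorphic graphs are isomorphic. -/
def SimpleGraph.Iso.boxProdCongr {V₁ V₂ W₁ W₂ : Type*} {G₁ : SimpleGraph V₁} {G₂ : SimpleGraph V₂}
    {H₁ : SimpleGraph W₁} {H₂ : SimpleGraph W₂} (e : G₁ ≃g H₁) (f : G₂ ≃g H₂) :
    SimpleGraph.boxProd G₁ G₂ ≃g SimpleGraph.boxProd H₁ H₂ where
  toEquiv := e.toEquiv.prodCongr f.toEquiv
  map_rel_iff' {a b} := by simp [SimpleGraph.boxProd_adj, e.map_adj_iff, f.map_adj_iff]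

/-- The product of a graph with a one-vertex graph. -/
def SimpleGraph.boxProdUniqueIso {V S : Type*} [Unique S] (H : SimpleGraph V) (T : SimpleGraph S) :
    SimpleGraph.boxProd H T ≃g H where
  toEquiv := Equiv.prodUnique V S
  map_rel_iff' {a b} := by simp [SimpleGraph.boxProd_adj, Subsingleton.elim a.2 b.2]

/-- The product construction is used twice: with factor `K₂` it passes from the square to `T □ K₂`,
which is `K₂ □ T`, and with factor `T` from this to `H □ T`. A one-vertex `T` is separate, because
it is not itself thick. -/
theorem SimpleGraph.HasThickComplex.boxProd_of_isTreeLike {V S : Type} [Fintype V] [Fintype S]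
    {H : SimpleGraph V} (hH : H.HasThickComplex) {T : SimpleGraph S} (hT : T.IsTreeLike) :
    (SimpleGraph.boxProd H T).HasThickComplex := by
  rcases subsingleton_or_nontrivial S with hS | hS
  · obtain ⟨s⟩ := hT.nonempty
    have : Unique S := ⟨⟨s⟩, fun a => Subsingleton.elim a s⟩
    exact hH.of_iso (H.boxProdUniqueIso T).symm
  · have htop : (⊤ : SimpleGraph (Fin 2)).IsTreeLike := by
      rw [← SimpleGraph.pathGraph_two_eq_top]
      exact .pathGraph 1
    refine hH.boxProd hT.neg_mem ?_
    exact ((hT.hasThickComplex hS).boxProd htop.neg_mem hasThickComplex_square).of_iso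
      (SimpleGraph.boxProdComm _ _)

/-- The first factor of a grid can be split off. -/
def gridSuccIso {n : ℕ} (m : Fin (n + 1) → ℕ) :
    grid m ≃g SimpleGraph.boxProd (SimpleGraph.pathGraph (m 0 + 1))
      (grid fun i : Fin n => m i.succ) where
  toEquiv := (Fin.consEquiv fun i => Fin (m i + 1)).symm
  map_rel_iff' {x y} := by
    change (_ ∧ (fun i : Fin n => x i.succ) = fun i : Fin n => y i.succ) ∨ (_ ∧ x 0 = y 0) ↔
      ∃ i, (SimpleGraph.pathGraph (m i + 1)).Adj (x i) (y i) ∧ ∀ j, j ≠ i → x j = y j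
    rw [Fin.exists_fin_succ]
    refine or_congr (and_congr Iff.rfl ?_) ?_
    · rw [funext_iff]
      simp [Fin.forall_fin_succ, Fin.succ_ne_zero]
    · change (∃ i, _ ∧ _) ∧ _ ↔ _
      rw [← exists_and_right]
      refine exists_congr fun i => ?_
      rw [and_assoc, Fin.forall_fin_succ]
      refine and_congr Iff.rfl ?_
      simp [and_comm, (Fin.succ_ne_zero _).symm]
      exact fun _ => Iff.rfl

theorem hasThickComplex_grid {n : ℕ} (m : Fin n → ℕ) (h : ∃ i, 1 ≤ m i) :
    (grid m).HasThickComplex := by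
  induction n with
  | zero => exact h.choose.elim0
  | succ n ih =>
    -- If only the first path has an edge, the remaining factor is a single vertex and induction
    -- does not apply to it.
    by_cases ht : ∃ i : Fin n, 1 ≤ m i.succ
    · exact (((ih _ ht).boxProd_of_isTreeLike (.pathGraph (m 0))).of_iso
        (SimpleGraph.boxProdComm _ _)).of_iso (gridSuccIso m).symm
    · have ht' : ∀ i : Fin n, m i.succ = 0 := by
        simpa using ht
      have h0 : 1 ≤ m 0 := by
        obtain ⟨i, hi⟩ := h
        rcases Fin.eq_zero_or_eq_succ i with rfl | ⟨j, rfl⟩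
        · exact hi
        · exact absurd ⟨j, hi⟩ ht
      have hsub : ∀ i : Fin n, Subsingleton (Fin (m i.succ + 1)) := by
        intro i
        rw [ht' i]
        exact inferInstanceAs (Subsingleton (Fin 1))
      have : Unique (∀ i : Fin n, Fin (m i.succ + 1)) :=
        ⟨⟨fun _ => 0⟩, fun _ => Subsingleton.elim _ _⟩
      have hnt : Nontrivial (Fin (m 0 + 1)) := Fin.nontrivial_iff_two_le.2 (by omega)
      exact (((SimpleGraph.IsTreeLike.pathGraph (m 0)).hasThickComplex hnt).of_iso
        (SimpleGraph.boxProdUniqueIso _ _).symm).of_iso (gridSuccIso m).symm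

theorem satisfiesSidorenko_grid {n : ℕ} (m : Fin n → ℕ) : (grid m).SatisfiesSidorenko := by
  by_cases h : ∃ i, 1 ≤ m i
  · exact (hasThickComplex_grid m h).satisfiesSidorenko
  · have hm : ∀ i, m i = 0 := by simpa using h
    have hsub : ∀ i, Subsingleton (Fin (m i + 1)) := by
      intro i
      rw [hm i]
      exact inferInstanceAs (Subsingleton (Fin 1))
    exact SimpleGraph.satisfiesSidorenko_of_subsingleton _

/-- The hypercube is a product of paths with two vertices. -/
def hypercubeIso (n : ℕ) : hypercube n ≃g grid fun _ : Fin n => 1 where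
  toEquiv := Equiv.piCongrRight fun _ => finTwoEquiv.symm
  map_rel_iff' {x y} := by
    have hadj : ∀ a b : Bool, (SimpleGraph.pathGraph 2).Adj (finTwoEquiv.symm a)
        (finTwoEquiv.symm b) ↔ a ≠ b := by
      simp [SimpleGraph.pathGraph_two_eq_top]
    change (∃ i, (SimpleGraph.pathGraph 2).Adj (finTwoEquiv.symm (x i)) (finTwoEquiv.symm (y i)) ∧
      ∀ j, j ≠ i → finTwoEquiv.symm (x j) = finTwoEquiv.symm (y j)) ↔ hammingDist x y = 1
    simp only [hadj, EmbeddingLike.apply_eq_iff_eq]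
    rw [hammingDist, Finset.card_eq_one]
    refine exists_congr fun i => ?_
    rw [Finset.eq_singleton_iff_unique_mem]
    simp only [Finset.mem_filter, Finset.mem_univ, true_and]
    exact and_congr Iff.rfl (forall_congr' fun j => not_imp_comm)

end

theorem mainTheorem8 :
    (∀ {V₁ : Type*} {V₂ : Type*} [Finite V₁] (H₁ : SimpleGraph V₁) (H₂ : SimpleGraph V₂),
      H₁.IsTree → H₂.IsThick → (SimpleGraph.boxProd H₁ H₂).IsThick) ∧
    (∀ n : ℕ, 1 ≤ n → (hypercube n).IsThick) ∧
    (∀ n : ℕ, (hypercube n).SatisfiesSidorenko) ∧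
    (∀ (n : ℕ) (m : Fin n → ℕ), (∃ i, 1 ≤ m i) → (grid m).IsThick) ∧
    (∀ (n : ℕ) (m : Fin n → ℕ), (grid m).SatisfiesSidorenko) := by
  refine ⟨?_, ?_, ?_, ?_, ?_⟩
  · intro V₁ V₂ _ H₁ H₂ hT hH
    obtain ⟨W, _, H, hc, ⟨e⟩⟩ := hH.exists_hasThickComplex
    -- Complexes have vertex sets in `Type`, so the tree is first moved to `Fin n`.
    obtain ⟨n, ⟨f⟩⟩ := Finite.exists_equiv_fin V₁
    have f' : H₁ ≃g H₁.map f.toEmbedding := SimpleGraph.Iso.map f H₁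
    exact (hc.boxProd_of_isTreeLike (f'.isTree_iff.1 hT).isTreeLike).isThick
      ((f'.boxProdCongr e).trans (SimpleGraph.boxProdComm _ _))
  · intro n hn
    exact (hasThickComplex_grid _ ⟨⟨0, hn⟩, le_rfl⟩).isThick (hypercubeIso n)
  · intro n
    exact (satisfiesSidorenko_grid _).of_iso (hypercubeIso n)
  · intro n m h
    exact (hasThickComplex_grid m h).isThick SimpleGraph.Iso.refl
  · intro n m
    exact satisfiesSidorenko_grid m
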